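/- **Setting.** Let $d\ge 1$. A quantum Kochen–Specker (KS) model consists of a complex Hilbert space $H$ with a unit vector $\psi$; sharp measurements $M_1,\dots,M_n$, where $M_j$ is given by mutually orthogonal projectors $(\Pi_j^m)_{m\in\mathbb Z/d}$ with $\sum_m\Pi_j^m=1$ (some may be zero; $d=2$ is the binary case); and maximal contexts $C_1,\dots,C_N\subseteq\{1,\dots,n\}$ ($N\ge1$), listed in some order, none contained in another, covering $\{1,\dots,n\}$, such that the projectors of measurements in one context commute. Its empirical correlations are $\wp(m\,|\,C_k)=\|\prod_{j\in C_k}\Pi_j^{m_j}\psi\|^2$. The model is *possibilistically KS contextual* if no probability distribution on global assignments $f\in(\mathbb Z/d)^n$ has, for every $k$, a marginal on $C_k$ with the same support as $\wp(\cdot|C_k)$. A *possibilistic proof* of the failure of KS noncontextuality, for the given order, consists of sets $\alpha_k$ of outcome vectors of $C_k$ with $$\wp(\alpha_1|C_1)>0,\qquad \wp(\alpha_k|C_k)=0\quad(k\ge 2),\tag{$*$}$$ such that no distribution on global assignments has context marginals satisfying the same relations. **The extended Wigner's friend scenario of the model.** There are Alice, her $n$ friends $F_1,\dots,F_n$, and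 $n$ Bobs. With $X|t\rangle=|t+1\rangle$, the system and the Bobs' qudits $T_1,\dots,T_n$ are prepared in $\big(\prod_j\mathrm{CNOT}_{ST_j}\big)\,\psi\otimes|0\rangle^{\otimes n}$, where $\mathrm{CNOT}_{ST_j}=\sum_m\Pi_j^m\otimes X^m_{T_j}$. Friend $F_j$'s measurement of $M_j$ is modelled by the unitary $U_j=\sum_m\Pi_j^m\otimes X^m_{F_j}$ on the system and her memory, which starts in $|0\rangle$; her outcome is $f_j$. The measurements in $C_1$ are performed first. Before each later context $C_k$, Alice makes, for every measurement $j\notin C_k$ that has been performed and not yet undone, a choice $x_j\in\{1,2\}$: if $x_j=1$ she reveals $f_j$ (the memory $F_j$ is projected onto $|f_j\rangle$). She then applies $U_j^\dagger$ for all these $j$, and the measurements in $C_k$ that were never performed before are performed. At the end she reveals all outcomes of measurements that were not undone. Bob $B_j$ measures $T_j$ in the computational basis if $y_j=1$ and in the Fourier basis if $y_j=2$ (the $\pm$ basis for $d=2$), with outcome $b_j$; outcome $+$ is the uniform superposition. A friend's outcome is in the future light cone of a choice of Alice's iff the measurement comes after the choice; the Bobs are space-like separated from Alice's side and from each other. The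 revealed $f_j$ and all $b_j$ are empirically accessible, with probabilities given by the Born rule. *Local Friendliness* holds for the scenario if there are probability distributions $P(f_1,\dots,f_n,b_1,\dots,b_n|x,y)$, one for each value of all choices, whose marginals on the accessible outcomes are the Born-rule probabilities (Absoluteness of Observed Events), and such that, with all other choices fixed, the marginal of $P$ on any set of outcomes outside the future light cone of a choice does not depend on that choice (Local Agency). **Theorem.** For every quantum KS model: 1. For all values of the choices, the Born-rule probabilities in the scenario are the marginal on the accessible outcomes of some probability distribution on all outcomes. 2. For every $P$ as in the definition of Local Friendliness, $P(b_{\rm All}=+\,|\,x_{\rm All}=2,y_{\rm All}=2)>0$, and the single distribution $Q(f)=P(f\,|\,x_{\rm All}=2,\,y_{\rm All}=2,\,b_{\rm All}=+)$ satisfies, for all sets $\alpha_k$ with $(*)$, $$Q(f_{C_1}\in\alpha_1)>0,\qquad Q(f_{C_k}\in\alpha_k)=0\quad(k\ge2).$$ 3. Consequently, if the model has a possibilistic proof of the failure of KS noncontextuality, then Local Friendliness fails in the scenario. 4. If the model is possibilistically KS contextual, then there is a context such that, for every ordering of the contexts that starts with it, the reordered model has a possibilistic proof of the failure of KS noncontextuality,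 and Local Friendliness fails in the scenario built with that ordering. -/

import Mathlib

open scoped BigOperators

noncomputable section

namespace LFKS

/-! ### Finite probability -/

open Classical in
/-- The probability of the event `E` under the weights `p` on a finite sample space. -/
def prob {Ω : Type*} [Fintype Ω] (p : Ω → ℝ) (E : Ω → Prop) : ℝ :=
  ∑ ω with E ω, p ω

/-! ### Kochen-Specker models -/

/-- A quantum realisation of a measurement scenario, with `n` sharp measurements whose outcomes lie
in `ZMod d` (some of the projectors may vanish; `d = 2` is the case of binary outcomes), maximal
contexts `ctx 0, …, ctx K` listed in a definite order, and a pure state `ψ` of the system. -/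
structure QuantumKSModel (d : ℕ) [NeZero d] (n K : ℕ) (H : Type*) [NormedAddCommGroup H]
    [InnerProductSpace ℂ H] [CompleteSpace H] where
  /-- `proj j m` is the projector of outcome `m` of measurement `j`. -/
  proj : Fin n → ZMod d → H →L[ℂ] H
  isStarProjection : ∀ j m, IsStarProjection (proj j m)
  orthogonal : ∀ j a b, a ≠ b → proj j a * proj j b = 0
  complete : ∀ j, ∑ m, proj j m = 1
  /-- The maximal contexts. -/
  ctx : Fin (K + 1) → Finset (Fin n)
  compatible : ∀ k, ∀ i ∈ ctx k, ∀ j ∈ ctx k, ∀ a b, Commute (proj i a) (proj j b)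
  maximal : ∀ k l, ctx k ⊆ ctx l → k = l
  covers : ∀ j, ∃ k, j ∈ ctx k
  /-- The state of the system. -/
  ψ : H
  norm_ψ : ‖ψ‖ = 1

namespace QuantumKSModel

variable {d : ℕ} [NeZero d] {n K : ℕ} {H : Type*} [NormedAddCommGroup H]
  [InnerProductSpace ℂ H] [CompleteSpace H] (M : QuantumKSModel d n K H)

/-- The projector of the joint outcome `m` of the context `ctx k`. -/
def ctxProj (k : Fin (K + 1)) (m : M.ctx k → ZMod d) : H →L[ℂ] H :=
  Finset.univ.noncommProd (fun j : M.ctx k => M.proj j (m j))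
    (fun i _ j _ _ => M.compatible k i i.2 j j.2 (m i) (m j))

/-- Born rule: the empirical correlation of the context `ctx k`. -/
def ctxBorn (k : Fin (K + 1)) (m : M.ctx k → ZMod d) : ℝ :=
  ‖M.ctxProj k m M.ψ‖ ^ 2

/-- The empirical probability that the outcome vector of the context `ctx k` lies in `α`. -/
def ctxProb (k : Fin (K + 1)) (α : Set (M.ctx k → ZMod d)) : ℝ :=
  prob (M.ctxBorn k) (fun m => m ∈ α)

/-- The probability, under a distribution `Q` on assignments of outcomes to all the measurements,
that the outcome vector of the context `ctx k` lies in `α`. -/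
def margProb (Q : (Fin n → ZMod d) → ℝ) (k : Fin (K + 1)) (α : Set (M.ctx k → ZMod d)) : ℝ :=
  prob Q (fun f => (fun j : M.ctx k => f j) ∈ α)

/-- No global distribution has context marginals with the same supports as the empirical
correlations. -/
def PossibilisticallyContextual : Prop :=
  ¬ ∃ Q ∈ stdSimplex ℝ (Fin n → ZMod d), ∀ (k : Fin (K + 1)) (m : M.ctx k → ZMod d),
    0 < M.margProb Q k {m} ↔ 0 < M.ctxBorn k m

/-- The event `α 0` is possible in the first context and each `α k` with `k ≠ 0` is impossible in
its context. -/
def SatisfiesPossibilistic (α : ∀ k, Set (M.ctx k → ZMod d)) : Prop :=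
  0 < M.ctxProb 0 (α 0) ∧ ∀ k, k ≠ 0 → M.ctxProb k (α k) = 0

/-- The same possibilistic relations for the context marginals of a global distribution. -/
def GlobalSatisfiesPossibilistic (Q : (Fin n → ZMod d) → ℝ)
    (α : ∀ k, Set (M.ctx k → ZMod d)) : Prop :=
  0 < M.margProb Q 0 (α 0) ∧ ∀ k, k ≠ 0 → M.margProb Q k (α k) = 0

/-- A possibilistic proof of the failure of Kochen-Specker noncontextuality: possibilistic relations
that hold for the empirical correlations but for no global distribution. -/
def IsPossibilisticProof (α : ∀ k, Set (M.ctx k → ZMod d)) : Prop :=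
  M.SatisfiesPossibilistic α ∧
    ¬ ∃ Q ∈ stdSimplex ℝ (Fin n → ZMod d), M.GlobalSatisfiesPossibilistic Q α

/-- The same model with its contexts listed in another order. -/
def reorder (σ : Equiv.Perm (Fin (K + 1))) : QuantumKSModel d n K H where
  proj := M.proj
  isStarProjection := M.isStarProjection
  orthogonal := M.orthogonal
  complete := M.complete
  ctx := fun k => M.ctx (σ k)
  compatible := fun k => M.compatible (σ k)
  maximal := fun _ _ h => σ.injective (M.maximal _ _ h)
  covers := fun j => by
    obtain ⟨k, hk⟩ := M.covers j
    exact ⟨σ.symm k, by simpa using hk⟩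
  ψ := M.ψ
  norm_ψ := M.norm_ψ

end QuantumKSModel

/-! ### Local Friendliness -/

/-- The value of a binary choice. -/
inductive Choice where
  | one
  | two

/-- An extended Wigner's friend scenario with free binary choices labelled by `S` and observed
outcomes labelled by `V` (all of which occur in every run) with values in `O`. -/
structure EWFScenario (S V O : Type) where
  /-- `inFuture s v`: the outcome `v` lies in the future light cone of the choice `s`. -/
  inFuture : S → V → Prop
  /-- `accessible z v`: the outcome `v` is empirically accessible in the runs with choices `z`. -/
  accessible : (S → Choice) → V → Prop
  /-- `emp z g`: the predicted probability that, in the runs with choices `z`, every accessible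
  outcome `v` has the value `g v`. -/
  emp : (S → Choice) → (V → O) → ℝ

namespace EWFScenario

variable {S V O : Type} [Fintype V] [DecidableEq V] [Fintype O]

/-- The weights `p` on all outcomes reproduce the empirical correlation of the runs with
choices `z`. -/
def Reproduces (E : EWFScenario S V O) (z : S → Choice) (p : (V → O) → ℝ) : Prop :=
  ∀ g, prob p (fun g' => ∀ v, E.accessible z v → g' v = g v) = E.emp z g

/-- Local Friendliness for the distributions `P z` of the outcomes given the choices. -/
structure LocalFriendliness (E : EWFScenario S V O) (P : (S → Choice) → (V → O) → ℝ) : Prop where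
  /-- Absoluteness of Observed Events: in the runs with given choices there is a joint distribution
  over all observed outcomes, -/
  absoluteness : ∀ z, P z ∈ stdSimplex ℝ (V → O)
  /-- and it has the empirical correlation as its marginal. -/
  empirical : ∀ z, E.Reproduces z (P z)
  /-- Local Agency: a choice is uncorrelated with any set of outcomes outside its future light
  cone. -/
  localAgency : ∀ (s : S) (z z' : S → Choice), (∀ s', s' ≠ s → z s' = z' s') →
    ∀ W : Set V, (∀ v ∈ W, ¬ E.inFuture s v) → ∀ g : V → O,
      prob (P z) (fun g' => ∀ v ∈ W, g' v = g v) = prob (P z') (fun g' => ∀ v ∈ W, g' v = g v)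

end EWFScenario

/-! ### The sequence of operations on Alice's side -/

/-- An operation on Alice's side: the friend of measurement `j` performs it; Alice chooses whether
to reveal its outcome; Alice applies the inverse of the unitary that models it; Alice reveals its
outcome at the end of the protocol. -/
inductive Step (n : ℕ) where
  | measure (j : Fin n)
  | choose (j : Fin n)
  | undo (j : Fin n)
  | disclose (j : Fin n)

/-- The remaining operations for the contexts in the list, when the measurements in `performed` have
been performed and those in `active` have been performed and not undone. Before a context `C` is
considered, a choice is made for every active measurement outside `C`, and all of these are undone;
then the measurements in `C` that were never performed before are performed. -/
def stepsFrom {n : ℕ} : Finset (Fin n) → Finset (Fin n) → List (Finset (Fin n)) → List (Step n)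
  | _, active, [] => ((List.finRange n).filter (· ∈ active)).map Step.disclose
  | performed, active, C :: Cs =>
      ((List.finRange n).filter (· ∈ active \ C)).map Step.choose ++
      ((List.finRange n).filter (· ∈ active \ C)).map Step.undo ++
      ((List.finRange n).filter (· ∈ C \ performed)).map Step.measure ++
      stepsFrom (performed ∪ C) ((active ∩ C) ∪ (C \ performed)) Cs

/-- A Bob's measurement basis: `bobVec y b` is the vector of outcome `b`, in the computational basis
for choice `1` and in the Fourier basis for choice `2`. For `d = 2` the latter is the `±` basis; the
outcome `0` is always the uniform superposition `+`. -/
def bobVec {d : ℕ} [NeZero d] (y : Choice) (b t : ZMod d) : ℂ :=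
  match y with
  | Choice.one => if t = b then 1 else 0
  | Choice.two => ((Real.sqrt d : ℝ) : ℂ)⁻¹ * ZMod.stdAddChar (b * t)

namespace QuantumKSModel

variable {d : ℕ} [NeZero d] {n K : ℕ} {H : Type*} [NormedAddCommGroup H]
  [InnerProductSpace ℂ H] [CompleteSpace H] (M : QuantumKSModel d n K H)

/-- The operations on Alice's side, in temporal order. -/
def steps : List (Step n) := stepsFrom ∅ ∅ (List.ofFn M.ctx)

/-- The labels of Alice's choices: one for each measurement that is undone at some point. -/
abbrev AliceChoice : Type := {j : Fin n // Step.choose j ∈ M.steps}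

/-- All choices: Alice's, and one for each Bob. -/
abbrev Setting : Type := M.AliceChoice ⊕ Fin n

/-! The system, `n` friends' memories (basis states `a`) and `n` Bobs' qudits (basis states `t`):
a vector of the tensor product is given by its components `Φ a t` in `H`. -/

/-- The controlled shift `∑ m, proj j m ⊗ X ^ m` on the system and the qudit of Bob `j`, where
`X` takes the basis state `t` to `t + 1` (a controlled-NOT for `d = 2`). -/
def cnot (j : Fin n) (Φ : (Fin n → ZMod d) → (Fin n → ZMod d) → H) :
    (Fin n → ZMod d) → (Fin n → ZMod d) → H :=
  fun a t => ∑ m, M.proj j m (Φ a (Function.update t j (t j - m)))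

/-- The unitary that models the measurement by friend `j`: the controlled shift on the system and
the friend's memory. -/
def friendU (j : Fin n) (Φ : (Fin n → ZMod d) → (Fin n → ZMod d) → H) :
    (Fin n → ZMod d) → (Fin n → ZMod d) → H :=
  fun a t => ∑ m, M.proj j m (Φ (Function.update a j (a j - m)) t)

/-- The inverse of `friendU j`. -/
def friendUInv (j : Fin n) (Φ : (Fin n → ZMod d) → (Fin n → ZMod d) → H) :
    (Fin n → ZMod d) → (Fin n → ZMod d) → H :=
  fun a t => ∑ m, M.proj j m (Φ (Function.update a j (a j + m)) t)

/-- Revealing the outcome of friend `j`, with result `v`: the projection of the friend's memory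
onto the basis state `v`. -/
def revealMem {d : ℕ} {n : ℕ} {H : Type*} [Zero H] (j : Fin n) (v : ZMod d)
    (Φ : (Fin n → ZMod d) → (Fin n → ZMod d) → H) :
    (Fin n → ZMod d) → (Fin n → ZMod d) → H :=
  fun a t => if a j = v then Φ a t else 0

open Classical in
/-- The initial state: the product of the controlled shifts over all Bobs, applied to `ψ` with all
Bobs' qudits in the basis state `0`; the friends' memories are in the ready state `0`. -/
def initialState : (Fin n → ZMod d) → (Fin n → ZMod d) → H :=
  (List.finRange n).foldr M.cnot (fun a t => if a = 0 ∧ t = 0 then M.ψ else 0)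

/-- Alice opens the lab of friend `j` when she is given the choice to do so. -/
def Opens (z : M.Setting → Choice) (j : Fin n) : Prop :=
  ∃ h : Step.choose j ∈ M.steps, z (Sum.inl ⟨j, h⟩) = Choice.one

open Classical in
/-- The effect of an operation on the unnormalised state, when the choices are `z` and the revealed
outcomes are given by `f`. -/
def applyStep (z : M.Setting → Choice) (f : Fin n → ZMod d)
    (Φ : (Fin n → ZMod d) → (Fin n → ZMod d) → H) :
    Step n → (Fin n → ZMod d) → (Fin n → ZMod d) → H
  | Step.measure j => M.friendU j Φ
  | Step.choose j => if M.Opens z j then revealMem j (f j) Φ else Φ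
  | Step.undo j => M.friendUInv j Φ
  | Step.disclose j => revealMem j (f j) Φ

/-- The unnormalised state at the end of the operations on Alice's side. -/
def finalState (z : M.Setting → Choice) (f : Fin n → ZMod d) :
    (Fin n → ZMod d) → (Fin n → ZMod d) → H :=
  M.steps.foldl (M.applyStep z f) M.initialState

/-- Born rule: the probability that, for the choices `z`, the revealed outcomes are given by `f` and
the Bobs' outcomes by `b`. -/
def protocolBorn (z : M.Setting → Choice) (f b : Fin n → ZMod d) : ℝ :=
  ∑ a, ‖∑ t, (∏ j, star (bobVec (z (Sum.inr j)) (b j) (t j))) • M.finalState z f a t‖ ^ 2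

/-- The extended Wigner's friend scenario built from the model. Outcomes are the friends' `Sum.inl j`
and the Bobs' `Sum.inr j`. A friend's outcome is in the future of a choice of Alice's iff the
measurement comes after the choice; the Bobs are space-like separated from Alice's side and from
each other. The friends' outcomes that Alice reveals and all the Bobs' outcomes are accessible. -/
def lfScenario : EWFScenario M.Setting (Fin n ⊕ Fin n) (ZMod d) where
  inFuture
    | Sum.inl j, Sum.inl i => List.Sublist [Step.choose j.1, Step.measure i] M.steps
    | Sum.inl _, Sum.inr _ => False
    | Sum.inr _, Sum.inl _ => False
    | Sum.inr j, Sum.inr i => i = j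
  accessible z
    | Sum.inl j => M.Opens z j ∨ Step.disclose j ∈ M.steps
    | Sum.inr _ => True
  emp z g := M.protocolBorn z (fun j => g (Sum.inl j)) (fun j => g (Sum.inr j))

/-- For given `P`, the probability that all the Bobs obtain `+` when all choices are `2`. -/
def plusProb (P : (M.Setting → Choice) → (Fin n ⊕ Fin n → ZMod d) → ℝ) : ℝ :=
  prob (P fun _ => Choice.two) (fun g => ∀ j, g (Sum.inr j) = 0)

/-- For given `P`, the distribution of all the friends' outcomes conditioned on all choices being
`2` and all the Bobs obtaining `+`. -/
def plusCond (P : (M.Setting → Choice) → (Fin n ⊕ Fin n → ZMod d) → ℝ)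
    (f : Fin n → ZMod d) : ℝ :=
  prob (P fun _ => Choice.two)
    (fun g => (∀ j, g (Sum.inl j) = f j) ∧ ∀ j, g (Sum.inr j) = 0) / M.plusProb P

end QuantumKSModel

end LFKS

end

open scoped BigOperators

noncomputable section

namespace LFKS

/-! ### Finite sums over partially determined functions -/

/-! The Bobs act on qudits that Alice's side never touches, so their outcomes can be conditioned on
first: contracting the Bobs' qudits leaves the friends' protocol running on the system vector
`bobState y b` (`protocolBorn_eq`). A Bob in the computational basis contributes the projector of
his outcome, and a Bob who finds `+` only a nonzero scalar. Hence "all `+`" leaves a multiple of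
`ψ`, while computational outcomes on a context and `+` elsewhere leave a multiple of `ctxProj`
applied to `ψ` (`bobState_eq_smul_ctxProj`). Every operation of Alice's is unitary or a projective
measurement made at most once per friend, so weights add up to one and the predictions are marginals
of distributions.

Given Local Friendliness, condition on all choices being `2` and all Bobs finding `+`. Outcomes of
the first context precede all of Alice's choices, so all outcomes may be revealed instead; the Born
rule then makes each possible outcome vector occur together with `+` (`prob_ctx_zero_pos`). For any
context `k`, the bases of the Bobs in it may be switched to computational without affecting the
friends and the other Bobs. In that setting each friend of the context agrees with her Bob: for one
`j` at a time, reveal only `j` by choice. Nothing is then revealed before `j` is measured, all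
earlier undoings are exact, and the system still carries her Bob's outcome (`prob_ne_eq_zero`). The
Bobs' outcomes obey the empirical zeros, hence so do the friends' (`prob_ctx_eq_zero`). The
conditional distribution is the same for every `k`, which contradicts a possibilistic proof.

In a possibilistically contextual model some possible outcome of some context extends to no global
assignment possible everywhere; otherwise the uniform distribution on such assignments would have
the right supports. Listing that context first gives a possibilistic proof. -/

open Classical in
/-- The functions that vanish where `p` fails. -/
def supportedOn {V O : Type*} [Fintype V] [DecidableEq V] [Fintype O] [Zero O] (p : V → Prop) :
    Finset (V → O) :=
  {g | ∀ v, ¬ p v → g v = 0}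

section Sums

variable {V O : Type*} [Fintype V] [DecidableEq V] [Fintype O] [Zero O]

lemma mem_supportedOn {p : V → Prop} {g : V → O} :
    g ∈ supportedOn p ↔ ∀ v, ¬ p v → g v = 0 := by
  simp [supportedOn]

/-- Functions vanishing off `p` serve as canonical representatives of functions defined only on `p`;
adding a point to the domain adds one independent summation variable. -/
lemma sum_supportedOn_insert {A : Type*} [AddCommMonoid A] {p q : V → Prop} {v : V}
    (hq : ∀ u, q u ↔ u = v ∨ p u) (hv : ¬ p v) (h : (V → O) → A) :
    ∑ g ∈ supportedOn q, h g =
      ∑ o, ∑ g ∈ supportedOn p, h (Function.update g v o) := by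
  rw [← Finset.sum_product']
  refine Finset.sum_bij' (fun g _ => (g v, Function.update g v 0))
    (fun x _ => Function.update x.2 v x.1) ?_ ?_ ?_ ?_ ?_
  · intro g hg
    rw [mem_supportedOn] at hg
    simp only [Finset.mem_product, Finset.mem_univ, true_and, mem_supportedOn]
    intro u hu
    by_cases huv : u = v
    · subst huv; simp
    · rw [Function.update_of_ne huv]
      exact hg u (by rw [hq]; tauto)
  · intro x hx
    simp only [Finset.mem_product, Finset.mem_univ, true_and, mem_supportedOn] at hx
    rw [mem_supportedOn]
    intro u hu
    rw [hq] at hu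
    push Not at hu
    rw [Function.update_of_ne hu.1]
    exact hx u hu.2
  · intro g _
    simp
  · rintro ⟨o, g⟩ hx
    simp only [Finset.mem_product, Finset.mem_univ, true_and, mem_supportedOn] at hx
    have : g v = 0 := hx v hv
    ext u
    · simp
    · by_cases huv : u = v
      · subst huv; simp [this]
      · simp [Function.update_of_ne huv]
  · intro g _
    simp

lemma supportedOn_true {p : V → Prop} (hp : ∀ v, p v) :
    supportedOn (O := O) p = Finset.univ := by
  ext g; simp [mem_supportedOn, hp]

lemma supportedOn_false {p : V → Prop} (hp : ∀ v, ¬ p v) :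
    supportedOn (O := O) p = {0} := by
  ext g
  simp only [mem_supportedOn, Finset.mem_singleton]
  exact ⟨fun h => funext fun v => h v (hp v), fun h v _ => by simp [h]⟩

omit [Fintype V] [DecidableEq V] [Fintype O] [Zero O] in
lemma foldl_congr_labels {σ E : Type*} (label : σ → Option V) (T : (V → O) → E → σ → E)
    (indep : ∀ s g g' e, (∀ v, label s = some v → g v = g' v) → T g e s = T g' e s)
    (L : List σ) (g g' : V → O) (hg : ∀ v ∈ L.filterMap label, g v = g' v) (e : E) :
    L.foldl (T g) e = L.foldl (T g') e := by
  induction L generalizing e with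
  | nil => rfl
  | cons s L ih =>
    simp only [List.foldl_cons]
    rw [indep s g g' e (fun v hv => hg v (List.mem_filterMap.2 ⟨s, by simp, hv⟩))]
    refine ih (fun v hv => hg v ?_) _
    rw [List.mem_filterMap] at hv ⊢
    obtain ⟨s', hs', h⟩ := hv
    exact ⟨s', by simp [hs'], h⟩

/-- A sequence of instruments, each of which is measured at most once, preserves the total
weight. -/
lemma sum_foldl_instruments {σ E : Type*} (label : σ → Option V) (T : (V → O) → E → σ → E)
    (N : E → ℝ)
    (indep : ∀ s g g' e, (∀ v, label s = some v → g v = g' v) → T g e s = T g' e s)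
    (hnone : ∀ s g e, label s = none → N (T g e s) = N e)
    (hsome : ∀ s v g e, label s = some v → ∑ o, N (T (Function.update g v o) e s) = N e)
    (L : List σ) (hL : (L.filterMap label).Nodup) (e : E) :
    ∑ g ∈ supportedOn (· ∈ L.filterMap label), N (L.foldl (T g) e) = N e := by
  induction L generalizing e with
  | nil => rw [supportedOn_false (by simp)]; simp
  | cons s L ih =>
    cases hs : label s with
    | none =>
      rw [List.filterMap_cons_none hs] at hL ⊢
      simp only [List.foldl_cons]
      rw [← hnone s 0 e hs, ← ih hL]
      refine Finset.sum_congr rfl fun g _ => ?_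
      rw [indep s g 0 e (by simp [hs])]
    | some v =>
      rw [List.filterMap_cons_some hs] at hL ⊢
      rw [List.nodup_cons] at hL
      rw [sum_supportedOn_insert (p := (· ∈ L.filterMap label)) (v := v) (by simp) hL.1,
        ← hsome s v 0 e hs]
      refine Finset.sum_congr rfl fun o _ => ?_
      rw [← ih hL.2]
      refine Finset.sum_congr rfl fun g _ => ?_
      rw [List.foldl_cons, indep s (Function.update g v o) (Function.update 0 v o) e]
      -- By `hL` no later step reads the value at `v`, so the update is invisible to the tail.
      · rw [foldl_congr_labels label T indep L (Function.update g v o) g]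
        intro u hu
        rw [Function.update_of_ne]
        rintro rfl
        exact hL.1 hu
      · intro u hu
        obtain rfl : v = u := by simpa [hs] using hu
        simp

/-! ### Probabilities of events -/

open Classical in
-- An event that depends only on the coordinates in `W` is a disjoint union of cylinders, each
-- represented by its member that vanishes off `W`. This passes from cylinders, for which Local
-- Agency is stated, to general events.
lemma prob_eq_sum_supportedOn (p : (V → O) → ℝ) (W : V → Prop) (F : (V → O) → Prop)
    (hF : ∀ g g', (∀ v, W v → g' v = g v) → F g → F g') :
    prob p F = prob (fun g => if g ∈ supportedOn W then
      prob p (fun g' => ∀ v, W v → g' v = g v) else 0) F := by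
  unfold prob
  rw [← Finset.sum_filter, Finset.filter_filter]
  rw [← Finset.sum_fiberwise_of_maps_to (g := fun g' v => if W v then g' v else 0)
    (t := {g | F g ∧ g ∈ supportedOn W})]
  · refine Finset.sum_congr rfl fun g hg => ?_
    simp only [Finset.mem_filter, Finset.mem_univ, true_and, mem_supportedOn] at hg
    rw [Finset.filter_filter]
    refine Finset.sum_congr ?_ fun _ _ => rfl
    ext g'
    simp only [Finset.mem_filter, Finset.mem_univ, true_and]
    constructor
    · rintro ⟨_, rfl⟩ v hv
      simp [hv]
    · intro h
      refine ⟨hF g g' h hg.1, ?_⟩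
      funext v
      by_cases hv : W v
      · simp [hv, h v hv]
      · simp [hv, hg.2 v hv]
  · intro g hg
    simp only [Finset.mem_filter, Finset.mem_univ, true_and, mem_supportedOn] at hg ⊢
    exact ⟨hF g _ (fun v hv => by simp [hv]) hg, fun v hv => by simp [hv]⟩

end Sums

lemma prob_nonneg {Ω : Type*} [Fintype Ω] {p : Ω → ℝ} (hp : ∀ ω, 0 ≤ p ω) (F : Ω → Prop) :
    0 ≤ prob p F :=
  Finset.sum_nonneg fun ω _ => hp ω

lemma prob_mono {Ω : Type*} [Fintype Ω] {p : Ω → ℝ} (hp : ∀ ω, 0 ≤ p ω) {F G : Ω → Prop}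
    (h : ∀ ω, F ω → G ω) : prob p F ≤ prob p G := by
  classical
  refine Finset.sum_le_sum_of_subset_of_nonneg (fun ω => ?_) (fun ω _ _ => hp ω)
  simpa using h ω

lemma prob_eq_zero_iff {Ω : Type*} [Fintype Ω] {p : Ω → ℝ} (hp : ∀ ω, 0 ≤ p ω)
    (F : Ω → Prop) : prob p F = 0 ↔ ∀ ω, F ω → p ω = 0 := by
  unfold prob
  rw [Finset.sum_eq_zero_iff_of_nonneg fun ω _ => hp ω]
  simp

lemma prob_pos_iff {Ω : Type*} [Fintype Ω] {p : Ω → ℝ} (hp : ∀ ω, 0 ≤ p ω)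
    (F : Ω → Prop) : 0 < prob p F ↔ ∃ ω, F ω ∧ 0 < p ω := by
  rw [(prob_nonneg hp F).lt_iff_ne', Ne, prob_eq_zero_iff hp]
  push Not
  exact exists_congr fun ω => and_congr_right fun _ => ((hp ω).lt_iff_ne').symm

/-! ### Consequences of Local Friendliness -/

namespace EWFScenario

variable {S V O : Type} [Fintype V] [DecidableEq V] [Fintype O] [Zero O]
  {E : EWFScenario S V O}

omit [Zero O] in
lemma Reproduces.eq_zero {z : S → Choice} {p : (V → O) → ℝ} (h : E.Reproduces z p)
    (hp : ∀ g, 0 ≤ p g) {g : V → O} (hg : E.emp z g = 0) : p g = 0 := by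
  rw [← h g, prob_eq_zero_iff hp] at hg
  exact hg g fun _ _ => rfl

omit [Zero O] in
lemma Reproduces.prob_pos {z : S → Choice} {p : (V → O) → ℝ} (h : E.Reproduces z p)
    (hp : ∀ g, 0 ≤ p g) {g : V → O} (hg : 0 < E.emp z g) {F : (V → O) → Prop}
    (hF : ∀ g', (∀ v, E.accessible z v → g' v = g v) → F g') : 0 < prob p F := by
  rw [← h g] at hg
  exact hg.trans_le (prob_mono hp hF)

open Classical in
-- The witness gives every inaccessible outcome the default value `0`.
lemma exists_reproduces {z : S → Choice} (hpos : ∀ g, 0 ≤ E.emp z g)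
    (hsum : ∑ g ∈ supportedOn (E.accessible z), E.emp z g = 1)
    (hdep : ∀ g g', (∀ v, E.accessible z v → g' v = g v) → E.emp z g' = E.emp z g) :
    ∃ p ∈ stdSimplex ℝ (V → O), E.Reproduces z p := by
  refine ⟨fun g => if g ∈ supportedOn (E.accessible z) then E.emp z g else 0,
    ⟨fun g => ?_, ?_⟩, fun g => ?_⟩
  · dsimp only
    split_ifs
    exacts [hpos g, le_rfl]
  · rw [← hsum, ← Finset.sum_filter]
    simp
  · unfold prob
    rw [Finset.sum_eq_single (fun v => if E.accessible z v then g v else 0)]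
    · rw [if_pos (mem_supportedOn.2 fun v hv => by simp [hv])]
      exact hdep _ _ fun v hv => by simp [hv]
    · intro g' hg' hne
      simp only [Finset.mem_filter, Finset.mem_univ, true_and] at hg'
      rw [if_neg]
      intro hs
      rw [mem_supportedOn] at hs
      refine hne (funext fun v => ?_)
      by_cases hv : E.accessible z v
      · simp [hv, hg' v hv]
      · simp [hv, hs v hv]
    · intro hn
      refine absurd ?_ hn
      simp only [Finset.mem_filter, Finset.mem_univ, true_and]
      intro v hv
      simp [hv]

/-- Local Agency for several choices and for general events. -/
lemma LocalFriendliness.prob_eq_of_notMem_future [Finite S]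
    {P : (S → Choice) → (V → O) → ℝ} (h : E.LocalFriendliness P) (W : V → Prop)
    (F : (V → O) → Prop) (hF : ∀ g g', (∀ v, W v → g' v = g v) → F g → F g')
    (z z' : S → Choice) (hz : ∀ s, z s ≠ z' s → ∀ v, W v → ¬ E.inFuture s v) :
    prob (P z) F = prob (P z') F := by
  classical
  rw [prob_eq_sum_supportedOn _ W F hF, prob_eq_sum_supportedOn (P z') W F hF]
  suffices ∀ g : V → O, prob (P z) (fun g' => ∀ v, W v → g' v = g v) =
      prob (P z') (fun g' => ∀ v, W v → g' v = g v) by simp only [this]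
  intro g
  have := Fintype.ofFinite S
  -- Local Agency changes one choice at a time; the induction is on a finite set containing all
  -- choices where `z` and `z'` differ.
  suffices ∀ T : Finset S, ∀ z : S → Choice, (∀ s, z s ≠ z' s → s ∈ T) →
      (∀ s, z s ≠ z' s → ∀ v, W v → ¬ E.inFuture s v) →
      prob (P z) (fun g' => ∀ v, W v → g' v = g v) =
      prob (P z') (fun g' => ∀ v, W v → g' v = g v) from
    this Finset.univ z (by simp) hz
  clear hz z
  intro T
  induction T using Finset.induction with
  | empty =>
    intro z hz _
    have : z = z' := funext fun s => by
      by_contra hs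
      simpa using hz s hs
    rw [this]
  | insert s T _ ih =>
    intro z hT hz
    by_cases hs : z s = z' s
    · refine ih z (fun s' hs' => ?_) hz
      rcases Finset.mem_insert.1 (hT s' hs') with rfl | h'
      · exact absurd hs hs'
      · exact h'
    · have h1 := h.localAgency s z (Function.update z s (z' s))
        (fun s' hs' => by rw [Function.update_of_ne hs']) {v | W v} (fun v hv => hz s hs v hv) g
      refine Eq.trans h1 (ih _ (fun s' hs' => ?_) (fun s' hs' => ?_))
      · by_cases hss : s' = s
        · subst hss; simp at hs'
        · rw [Function.update_of_ne hss] at hs'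
          exact (Finset.mem_insert.1 (hT s' hs')).resolve_left hss
      · by_cases hss : s' = s
        · subst hss; simp at hs'
        · rw [Function.update_of_ne hss] at hs'
          exact hz s' hs'

end EWFScenario

lemma sum_norm_sq_bobVec {d : ℕ} [NeZero d] (y : Choice) (m : ZMod d) :
    ∑ b, ‖star (bobVec y b m)‖ ^ 2 = 1 := by
  cases y with
  | one => simp [bobVec, apply_ite]
  | two =>
    have h (b : ZMod d) : ‖star (bobVec Choice.two b m)‖ ^ 2 = (d : ℝ)⁻¹ := by
      rw [norm_star, bobVec, norm_mul, norm_inv, Complex.norm_real, ZMod.stdAddChar_apply,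
        Circle.norm_coe, mul_one, Real.norm_of_nonneg (Real.sqrt_nonneg _), inv_pow,
        Real.sq_sqrt (Nat.cast_nonneg d)]
    simp only [h, Finset.sum_const, Finset.card_univ, ZMod.card, nsmul_eq_mul]
    exact mul_inv_cancel₀ (Nat.cast_ne_zero.2 (NeZero.ne d))

namespace QuantumKSModel

variable {d : ℕ} [NeZero d] {n K : ℕ} {H : Type*} [NormedAddCommGroup H]
  [InnerProductSpace ℂ H] [CompleteSpace H] (M : QuantumKSModel d n K H)

/-! ### Projectors -/

lemma proj_proj (j : Fin n) (m m' : ZMod d) (x : H) :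
    M.proj j m (M.proj j m' x) = if m = m' then M.proj j m x else 0 := by
  split_ifs with h
  · subst h
    exact congrArg (· x) (M.isStarProjection j m).isIdempotentElem
  · exact congrArg (· x) (M.orthogonal j m m' h)

lemma sum_proj (j : Fin n) (x : H) : ∑ m, M.proj j m x = x := by
  have := congrArg (· x) (M.complete j)
  simpa [sum_apply] using this

lemma inner_proj_proj (j : Fin n) {m m' : ZMod d} (h : m ≠ m') (x y : H) :
    inner ℂ (M.proj j m x) (M.proj j m' y) = 0 := by
  have hs := (M.isStarProjection j m).isSelfAdjoint
  rw [ContinuousLinearMap.isSelfAdjoint_iff'] at hs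
  rw [← hs, ContinuousLinearMap.adjoint_inner_left, M.proj_proj, if_neg h, inner_zero_right]

lemma norm_sq_sum_proj (j : Fin n) (x : ZMod d → H) :
    ‖∑ m, M.proj j m (x m)‖ ^ 2 = ∑ m, ‖M.proj j m (x m)‖ ^ 2 := by
  have h : ∀ s : Finset (ZMod d),
      ‖∑ m ∈ s, M.proj j m (x m)‖ ^ 2 = ∑ m ∈ s, ‖M.proj j m (x m)‖ ^ 2 := by
    intro s
    induction s using Finset.induction with
    | empty => simp
    | insert a s ha ih =>
      rw [Finset.sum_insert ha, Finset.sum_insert ha, ← ih]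
      have : inner ℂ (M.proj j a (x a)) (∑ m ∈ s, M.proj j m (x m)) = 0 := by
        rw [inner_sum]
        refine Finset.sum_eq_zero fun m hm => M.inner_proj_proj j ?_ _ _
        rintro rfl
        exact ha hm
      simpa [sq] using norm_add_sq_eq_norm_sq_add_norm_sq_of_inner_eq_zero _ _ this
  exact h _

lemma sum_norm_sq_proj (j : Fin n) (x : H) : ∑ m, ‖M.proj j m x‖ ^ 2 = ‖x‖ ^ 2 := by
  rw [← M.norm_sq_sum_proj j fun _ => x, M.sum_proj]

/-! ### Operations on the system and the memories -/

/-- The controlled shift of the memory `j`, with outcome `m` shifting by `-s m`. -/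
def memCtrl (j : Fin n) (s : ZMod d → ZMod d) (Φ : (Fin n → ZMod d) → H) :
    (Fin n → ZMod d) → H :=
  fun a => ∑ m, M.proj j m (Φ (Function.update a j (a j + s m)))

/-- The projection of the memory `j` onto the basis state `v`. -/
def memReveal {d : ℕ} {n : ℕ} {H : Type*} [Zero H] (j : Fin n) (v : ZMod d)
    (Φ : (Fin n → ZMod d) → H) : (Fin n → ZMod d) → H :=
  fun a => if a j = v then Φ a else 0

/-- The squared norm of a vector of the system and the memories. -/
def memNormSq (Φ : (Fin n → ZMod d) → H) : ℝ := ∑ a, ‖Φ a‖ ^ 2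

open Classical in
/-- The effect of an operation on the system and the memories, when Alice reveals the outcomes
selected by `op` and they are given by `f`. -/
def memStep (op : Fin n → Prop) (f : Fin n → ZMod d) (Φ : (Fin n → ZMod d) → H) :
    Step n → (Fin n → ZMod d) → H
  | Step.measure j => M.memCtrl j (fun m => -m) Φ
  | Step.choose j => if op j then memReveal j (f j) Φ else Φ
  | Step.undo j => M.memCtrl j (fun m => m) Φ
  | Step.disclose j => memReveal j (f j) Φ

/-- The vector `φ` of the system with all the memories in the ready state. -/
def ready (φ : H) : (Fin n → ZMod d) → H := fun a => if a = 0 then φ else 0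

/-- On the range of each projector the operation permutes the memory's basis states, and the ranges
are orthogonal. Arbitrary `s` covers measuring and undoing at once. -/
lemma memNormSq_memCtrl (j : Fin n) (s : ZMod d → ZMod d) (Φ : (Fin n → ZMod d) → H) :
    memNormSq (M.memCtrl j s Φ) = memNormSq Φ := by
  unfold memNormSq memCtrl
  simp only [M.norm_sq_sum_proj]
  rw [Finset.sum_comm]
  have (m : ZMod d) : ∑ a : Fin n → ZMod d,
      ‖M.proj j m (Φ (Function.update a j (a j + s m)))‖ ^ 2 =
      ∑ a, ‖M.proj j m (Φ a)‖ ^ 2 := by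
    refine Fintype.sum_equiv (Equiv.addRight (Pi.single j (s m))) _ _ fun a => ?_
    congr 4
    ext i
    by_cases h : i = j
    · subst h; simp
    · simp [h]
  simp only [this]
  rw [Finset.sum_comm]
  exact Finset.sum_congr rfl fun a _ => M.sum_norm_sq_proj j _

omit [InnerProductSpace ℂ H] [CompleteSpace H] in
lemma sum_memNormSq_memReveal (j : Fin n) (Φ : (Fin n → ZMod d) → H) :
    ∑ v, memNormSq (memReveal j v Φ) = memNormSq Φ := by
  unfold memNormSq memReveal
  rw [Finset.sum_comm]
  refine Finset.sum_congr rfl fun a _ => ?_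
  rw [Finset.sum_eq_single (a j)] <;> simp +contextual [eq_comm]

omit [InnerProductSpace ℂ H] [CompleteSpace H] in
lemma memNormSq_ready (φ : H) : memNormSq (ready (d := d) (n := n) φ) = ‖φ‖ ^ 2 := by
  unfold memNormSq ready
  rw [Finset.sum_eq_single 0] <;> simp +contextual

omit [InnerProductSpace ℂ H] [CompleteSpace H] in
lemma memNormSq_zero : memNormSq (0 : (Fin n → ZMod d) → H) = 0 := by
  simp [memNormSq]

lemma memCtrl_zero (j : Fin n) (s : ZMod d → ZMod d) : M.memCtrl j s 0 = 0 := by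
  funext a; simp [memCtrl]

omit [NeZero d] [InnerProductSpace ℂ H] [CompleteSpace H] in
lemma memReveal_zero (j : Fin n) (v : ZMod d) :
    memReveal j v (0 : (Fin n → ZMod d) → H) = 0 := by
  funext a; simp [memReveal]

omit [NeZero d] [InnerProductSpace ℂ H] [CompleteSpace H] in
lemma memReveal_memReveal (i j : Fin n) (v w : ZMod d) (Φ : (Fin n → ZMod d) → H) :
    memReveal i v (memReveal j w Φ) = memReveal j w (memReveal i v Φ) := by
  funext a; simp only [memReveal]; split_ifs <;> rfl

omit [NeZero d] [InnerProductSpace ℂ H] [CompleteSpace H] in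
lemma memReveal_idem (j : Fin n) (v : ZMod d) (Φ : (Fin n → ZMod d) → H) :
    memReveal j v (memReveal j v Φ) = memReveal j v Φ := by
  funext a; simp only [memReveal]; split_ifs <;> rfl

lemma memReveal_memCtrl {i j : Fin n} (h : j ≠ i) (v : ZMod d) (s : ZMod d → ZMod d)
    (Φ : (Fin n → ZMod d) → H) :
    memReveal j v (M.memCtrl i s Φ) = M.memCtrl i s (memReveal j v Φ) := by
  funext a
  simp only [memReveal, memCtrl, Function.update_of_ne h]
  split_ifs <;> simp

lemma memCtrl_comm {i j : Fin n} (h : i ≠ j)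
    (hc : ∀ a b, Commute (M.proj i a) (M.proj j b)) (s s' : ZMod d → ZMod d)
    (Φ : (Fin n → ZMod d) → H) :
    M.memCtrl i s (M.memCtrl j s' Φ) = M.memCtrl j s' (M.memCtrl i s Φ) := by
  funext a
  simp only [memCtrl, map_sum, Function.update_of_ne h, Function.update_of_ne h.symm]
  rw [Finset.sum_comm]
  refine Finset.sum_congr rfl fun m' _ => Finset.sum_congr rfl fun m _ => ?_
  rw [Function.update_comm h]
  exact DFunLike.congr_fun (hc m m').eq _

lemma memCtrl_inverse (j : Fin n) (Φ : (Fin n → ZMod d) → H) :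
    M.memCtrl j (fun m => m) (M.memCtrl j (fun m => -m) Φ) = Φ := by
  funext a
  simp only [memCtrl, map_sum, Function.update_self, Function.update_idem, M.proj_proj]
  simp only [Finset.sum_ite_eq, Finset.mem_univ, if_true]
  simp [M.sum_proj]

open Classical in
/-- The controlled shifts of distinct memories, applied to ready memories. -/
lemma foldr_memCtrl_ready (l : List (Fin n)) (hl : l.Nodup) (φ : H) (a : Fin n → ZMod d) :
    l.foldr (fun j Φ => M.memCtrl j (fun m => -m) Φ) (ready φ) a =
      if ∀ j, j ∉ l → a j = 0 then (l.map fun j => M.proj j (a j)).prod φ else 0 := by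
  induction l generalizing a with
  | nil => simp [ready, funext_iff]
  | cons j l ih =>
    rw [List.nodup_cons] at hl
    simp only [List.foldr_cons, memCtrl, ih hl.2]
    -- Memory `j` is still `0` before its own shift, because `j ∉ l`; only the outcome `m = a j`
    -- contributes.
    rw [Finset.sum_eq_single (a j)]
    · simp only [add_neg_cancel]
      have h1 : (∀ i, i ∉ l → Function.update a j 0 i = 0) ↔ ∀ i, i ∉ j :: l → a i = 0 := by
        refine forall_congr' fun i => ?_
        by_cases h : i = j
        · subst h; simp
        · simp [h]
      simp only [h1]
      split_ifs
      · rw [List.map_cons, List.prod_cons, mul_apply_eq_comp]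
        congr 3
        refine List.map_congr_left fun i hi => ?_
        rw [Function.update_of_ne]
        rintro rfl
        exact hl.1 hi
      · simp
    · intro m _ hm
      rw [if_neg, map_zero]
      intro h
      have := h j hl.1
      rw [Function.update_self, ← sub_eq_add_neg, sub_eq_zero] at this
      exact hm this.symm
    · simp

/-! ### Reduction of the Bobs' measurements to operators on the system -/

/-- The operator on the system of outcome `b` of Bob `j`. -/
def bobOp (w : Fin n → ZMod d → ℂ) (j : Fin n) : H →L[ℂ] H := ∑ m, w j m • M.proj j m

/-- Distributivity, with the order of the factors kept because projectors of different measurements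
need not commute. -/
lemma sum_prod_proj (w : Fin n → ZMod d → ℂ) (l : List (Fin n)) (hl : l.Nodup) (φ : H) :
    ∑ t ∈ supportedOn (· ∈ l), (l.map fun j => w j (t j)).prod •
      (l.map fun j => M.proj j (t j)).prod φ = (l.map (M.bobOp w)).prod φ := by
  induction l with
  | nil => rw [supportedOn_false (by simp)]; simp
  | cons j l ih =>
    rw [List.nodup_cons] at hl
    rw [sum_supportedOn_insert (p := (· ∈ l)) (v := j) (by simp) hl.1, List.map_cons,
      List.prod_cons, mul_apply_eq_comp, bobOp, sum_apply]
    refine Finset.sum_congr rfl fun m _ => ?_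
    rw [smul_apply, ← ih hl.2, map_sum, Finset.smul_sum]
    refine Finset.sum_congr rfl fun t _ => ?_
    have hu (i) (hi : i ∈ l) : Function.update t j m i = t i := by
      rw [Function.update_of_ne]
      rintro rfl
      exact hl.1 hi
    rw [List.map_cons, List.prod_cons, List.map_cons, List.prod_cons, Function.update_self,
      List.map_congr_left (g := fun i => w i (t i)) fun i hi => by rw [hu i hi],
      List.map_congr_left (g := fun i => M.proj i (t i)) fun i hi => by rw [hu i hi],
      mul_apply_eq_comp, map_smul, smul_smul]

/-- The vector of the system after the Bobs have obtained the outcomes `b` in the bases `y`. -/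
def bobState (y : Fin n → Choice) (b : Fin n → ZMod d) : H :=
  ((List.finRange n).map (M.bobOp fun j m => star (bobVec (y j) (b j) m))).prod M.ψ

/-- The contraction of a vector with the vector `w` of the Bobs' qudits. -/
def contract (w : (Fin n → ZMod d) → ℂ) (Φ : (Fin n → ZMod d) → (Fin n → ZMod d) → H) :
    (Fin n → ZMod d) → H :=
  fun a => ∑ t, w t • Φ a t

/-- Alice's operations are linear and leave the Bobs' qudits alone, so they commute with the
contraction. -/
lemma contract_applyStep (w : (Fin n → ZMod d) → ℂ) (z : M.Setting → Choice)
    (f : Fin n → ZMod d) (Φ : (Fin n → ZMod d) → (Fin n → ZMod d) → H) (s : Step n) :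
    M.memStep (M.Opens z) f (contract w Φ) s = contract w (M.applyStep z f Φ s) := by
  funext a
  cases s with
  | measure j =>
    simp only [memStep, applyStep, memCtrl, contract, friendU, map_sum, map_smul,
      Finset.smul_sum, sub_eq_add_neg]
    exact Finset.sum_comm
  | undo j =>
    simp only [memStep, applyStep, memCtrl, contract, friendUInv, map_sum, map_smul,
      Finset.smul_sum]
    exact Finset.sum_comm
  | choose j =>
    simp only [memStep, applyStep]
    split_ifs
    · simp only [memReveal, contract, revealMem]
      split_ifs <;> simp
    · rfl
  | disclose j =>
    simp only [memStep, applyStep, memReveal, contract, revealMem]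
    split_ifs <;> simp

/-- The Bobs' controlled shifts have the same form as the friends' measurements, so
`foldr_memCtrl_ready` applies with the Bobs' qudits in the role of the memories. -/
lemma contract_initialState (y : Fin n → Choice) (b : Fin n → ZMod d) :
    contract (fun t => ∏ j, star (bobVec (y j) (b j) (t j))) M.initialState =
      ready (M.bobState y b) := by
  classical
  funext a
  have h (l : List (Fin n)) : l.foldr M.cnot
      (fun a t => if a = 0 ∧ t = 0 then M.ψ else 0) a =
      l.foldr (fun j Φ => M.memCtrl j (fun m => -m) Φ) (ready (if a = 0 then M.ψ else 0)) := by
    induction l with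
    | nil => funext t; by_cases ha : a = 0 <;> simp [ready, ha]
    | cons j l ih =>
      funext t
      simp only [List.foldr_cons, ← ih]
      simp [cnot, memCtrl, sub_eq_add_neg]
  have hi : M.initialState a = (List.finRange n).foldr
      (fun j Φ => M.memCtrl j (fun m => -m) Φ) (ready (if a = 0 then M.ψ else 0)) := by
    rw [← h]
    unfold initialState
    congr!
  simp only [contract, hi]
  simp only [M.foldr_memCtrl_ready _ (List.nodup_finRange n), List.mem_finRange, not_true_eq_false,
    false_implies, implies_true, if_true]
  have := M.sum_prod_proj (fun j m => star (bobVec (y j) (b j) m)) _ (List.nodup_finRange n)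
    (if a = 0 then M.ψ else 0)
  rw [supportedOn_true (by simp)] at this
  simp only [Fin.prod_univ_def]
  rw [this, bobState, ready]
  split_ifs <;> simp

lemma protocolBorn_eq (z : M.Setting → Choice) (f b : Fin n → ZMod d) :
    M.protocolBorn z f b = memNormSq (M.steps.foldl (M.memStep (M.Opens z) f)
      (ready (M.bobState (fun j => z (Sum.inr j)) b))) := by
  rw [← contract_initialState,
    List.foldl_hom (contract _) (fun Φ s => M.contract_applyStep _ z f Φ s)]
  rfl

/-- The Bobs' outcomes have total probability one. -/
lemma sum_norm_sq_bobState (y : Fin n → Choice) : ∑ b, ‖M.bobState y b‖ ^ 2 = 1 := by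
  have h := sum_foldl_instruments (O := ZMod d) (some : Fin n → Option (Fin n))
    (fun b x j => M.bobOp (fun j m => star (bobVec (y j) (b j) m)) j x) (fun x => ‖x‖ ^ 2)
    (fun j g g' x hg => by simp only [bobOp, hg j rfl]) (fun s g e hs => by simp at hs)
    (fun j v g x hv => by
      obtain rfl : j = v := by simpa using hv
      simp only [bobOp, sum_apply, smul_apply,
        Function.update_self, ← map_smul, M.norm_sq_sum_proj]
      rw [Finset.sum_comm]
      simp only [map_smul, norm_smul, mul_pow, ← Finset.sum_mul, sum_norm_sq_bobVec, one_mul]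
      exact M.sum_norm_sq_proj j x)
    -- The list is reversed because a product of operators applies its last factor first.
    (List.finRange n).reverse (by simp [List.nodup_finRange]) M.ψ
  rw [supportedOn_true (by simp), M.norm_ψ, one_pow] at h
  rw [← h]
  refine Finset.sum_congr rfl fun b _ => ?_
  rw [bobState, List.foldl_reverse]
  congr 2
  generalize List.finRange n = l
  induction l with
  | nil => simp
  | cons j l ih => rw [List.map_cons, List.prod_cons, mul_apply_eq_comp, ih, List.foldr_cons]

end QuantumKSModel

/-! ### The sequence of steps -/

section Steps

variable {n : ℕ}

open Classical in
/-- The friend whose outcome is revealed in a step, when Alice reveals the outcomes selected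
by `op`. -/
def revealLabel (op : Fin n → Prop) : Step n → Option (Fin n)
  | Step.measure _ => none
  | Step.choose j => if op j then some j else none
  | Step.undo _ => none
  | Step.disclose j => some j

lemma mem_filterMap_revealLabel {op : Fin n → Prop} {L : List (Step n)} {j : Fin n} :
    j ∈ L.filterMap (revealLabel op) ↔
      (Step.choose j ∈ L ∧ op j) ∨ Step.disclose j ∈ L := by
  rw [List.mem_filterMap]
  constructor
  · rintro ⟨s, hs, h⟩
    cases s with
    | measure i => simp [revealLabel] at h
    | undo i => simp [revealLabel] at h
    | choose i =>
      simp only [revealLabel, Option.ite_none_right_eq_some, Option.some.injEq] at h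
      obtain ⟨h, rfl⟩ := h
      exact Or.inl ⟨hs, h⟩
    | disclose i =>
      simp only [revealLabel, Option.some.injEq] at h
      subst h
      exact Or.inr hs
  · rintro (⟨h, ho⟩ | h)
    · exact ⟨_, h, by simp [revealLabel, ho]⟩
    · exact ⟨_, h, rfl⟩

lemma measure_notMem_stepsFrom {p a : Finset (Fin n)} {Cs : List (Finset (Fin n))} {j : Fin n}
    (hj : j ∈ p) : Step.measure j ∉ stepsFrom p a Cs := by
  induction Cs generalizing p a with
  | nil => simp [stepsFrom]
  | cons C Cs ih =>
    have := ih (p := p ∪ C) (a := (a ∩ C) ∪ (C \ p)) (by simp [hj])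
    simp [stepsFrom, hj, this]

/-- A choice concerns a measurement already performed, and a performed measurement is never
performed again. -/
lemma not_sublist_choose_measure {p a : Finset (Fin n)} {Cs : List (Finset (Fin n))}
    (hap : a ⊆ p) (j : Fin n) :
    ¬ List.Sublist [Step.choose j, Step.measure j] (stepsFrom p a Cs) := by
  induction Cs generalizing p a with
  | nil =>
    intro h
    have := h.subset (a := Step.choose j) (by simp)
    simp [stepsFrom] at this
  | cons C Cs ih =>
    intro h
    by_cases hj : j ∈ p
    · exact measure_notMem_stepsFrom hj (h.subset (by simp))
    · rw [stepsFrom, List.sublist_append_iff] at h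
      obtain ⟨l₁, l₂, hl, h₁, h₂⟩ := h
      cases l₁ with
      | nil =>
        simp only [List.nil_append] at hl
        subst hl
        refine ih (p := p ∪ C) (a := (a ∩ C) ∪ (C \ p)) ?_ h₂
        intro i hi
        simp only [Finset.mem_union, Finset.mem_inter, Finset.mem_sdiff] at hi ⊢
        tauto
      | cons s l₁ =>
        simp only [List.cons_append, List.cons.injEq] at hl
        have : Step.choose j ∈ s :: l₁ := by simp [hl.1]
        have := h₁.subset this
        simp only [List.append_assoc, List.mem_append, List.mem_map, Step.choose.injEq,
          exists_eq_right, List.mem_filter, reduceCtorEq, and_false, exists_false, or_false,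
          Finset.mem_sdiff, decide_eq_true_eq] at this
        exact hj (hap this.2.1)

lemma reveal_mem_stepsFrom {p a : Finset (Fin n)} {Cs : List (Finset (Fin n))} {j : Fin n}
    (h : Step.choose j ∈ stepsFrom p a Cs ∨ Step.disclose j ∈ stepsFrom p a Cs) :
    j ∈ a ∨ j ∉ p := by
  induction Cs generalizing p a with
  | nil => simp [stepsFrom] at h; tauto
  | cons C Cs ih =>
    have := ih (p := p ∪ C) (a := (a ∩ C) ∪ (C \ p))
    simp [stepsFrom] at h this
    tauto

/-- Once active, a measurement either falls outside some later context, where a choice is made, or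
stays active until the final disclosure. -/
lemma exists_reveal_mem_stepsFrom {p a : Finset (Fin n)} {Cs : List (Finset (Fin n))}
    {j : Fin n} (h : j ∈ a ∨ (j ∉ p ∧ ∃ C ∈ Cs, j ∈ C)) :
    Step.choose j ∈ stepsFrom p a Cs ∨ Step.disclose j ∈ stepsFrom p a Cs := by
  induction Cs generalizing p a with
  | nil => simp at h; simp [stepsFrom, h]
  | cons C Cs ih =>
    have := ih (p := p ∪ C) (a := (a ∩ C) ∪ (C \ p))
    simp [stepsFrom] at h this ⊢
    by_cases hC : j ∈ C <;> by_cases ha : j ∈ a <;> simp_all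

/-- After its choice a measurement is undone: it is performed but inactive, and by
`reveal_mem_stepsFrom` it is never revealed again. -/
lemma nodup_filterMap_revealLabel {op : Fin n → Prop} {p a : Finset (Fin n)}
    {Cs : List (Finset (Fin n))} (hap : a ⊆ p) :
    ((stepsFrom p a Cs).filterMap (revealLabel op)).Nodup := by
  have hd (l : List (Fin n)) : (l.map Step.disclose).filterMap (revealLabel op) = l := by
    induction l with
    | nil => rfl
    | cons i l ih => rw [List.map_cons, List.filterMap_cons_some (f := revealLabel op) (b := i) rfl, ih]
  have hm (l : List (Fin n)) : (l.map Step.measure).filterMap (revealLabel op) = [] := by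
    induction l with
    | nil => rfl
    | cons i l ih => rw [List.map_cons, List.filterMap_cons_none rfl, ih]
  have hu (l : List (Fin n)) : (l.map Step.undo).filterMap (revealLabel op) = [] := by
    induction l with
    | nil => rfl
    | cons i l ih => rw [List.map_cons, List.filterMap_cons_none rfl, ih]
  have hc (l : List (Fin n)) :
      List.Sublist ((l.map Step.choose).filterMap (revealLabel op)) l := by
    induction l with
    | nil => exact List.Sublist.refl _
    | cons i l ih =>
      by_cases h : op i
      · rw [List.map_cons, List.filterMap_cons_some (b := i) (by simp [revealLabel, h])]
        exact ih.cons_cons i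
      · rw [List.map_cons, List.filterMap_cons_none (by simp [revealLabel, h])]
        exact ih.cons i
  induction Cs generalizing p a with
  | nil => rw [stepsFrom, hd]; exact (List.nodup_finRange n).filter _
  | cons C Cs ih =>
    rw [stepsFrom]
    simp only [List.filterMap_append, hm, hu, List.append_nil]
    rw [List.nodup_append']
    refine ⟨((List.nodup_finRange n).filter _).sublist (hc _), ih ?_, ?_⟩
    · intro i hi
      simp only [Finset.mem_union, Finset.mem_inter, Finset.mem_sdiff] at hi ⊢
      tauto
    · intro i hi hi'
      have h1 := (hc _).subset hi
      have h2 := reveal_mem_stepsFrom ((mem_filterMap_revealLabel.1 hi').imp_left And.left)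
      have h3 := @hap i
      simp at h1 h2
      tauto

end Steps

namespace QuantumKSModel

variable {d : ℕ} [NeZero d] {n K : ℕ} {H : Type*} [NormedAddCommGroup H]
  [InnerProductSpace ℂ H] [CompleteSpace H] (M : QuantumKSModel d n K H)

/-! ### Revealing an outcome early -/

section Reveal

variable (op : Fin n → Prop) (f : Fin n → ZMod d)

lemma foldl_memStep_zero (L : List (Step n)) : L.foldl (M.memStep op f) 0 = 0 := by
  induction L with
  | nil => rfl
  | cons s L ih =>
    rw [List.foldl_cons]
    have : M.memStep op f 0 s = 0 := by
      cases s <;> simp only [memStep, memCtrl_zero, memReveal_zero, ite_self]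
    rw [this, ih]

lemma foldl_memStep_memReveal {L : List (Step n)} {j : Fin n} (hm : Step.measure j ∉ L)
    (hu : Step.undo j ∉ L) (v : ZMod d) (Φ : (Fin n → ZMod d) → H) :
    L.foldl (M.memStep op f) (memReveal j v Φ) =
      memReveal j v (L.foldl (M.memStep op f) Φ) := by
  induction L generalizing Φ with
  | nil => rfl
  | cons s L ih =>
    simp only [List.mem_cons, not_or] at hm hu
    rw [List.foldl_cons, List.foldl_cons, ← ih hm.2 hu.2]
    congr 1
    cases s with
    | measure i =>
      exact (M.memReveal_memCtrl (fun h => hm.1 (by rw [h])) v _ Φ).symm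
    | undo i =>
      exact (M.memReveal_memCtrl (fun h => hu.1 (by rw [h])) v _ Φ).symm
    | choose i =>
      simp only [memStep]
      split_ifs
      · exact memReveal_memReveal _ _ _ _ _
      · rfl
    | disclose i => exact memReveal_memReveal _ _ _ _ _

/-- The extra projection commutes forward to the step that performs the same projection, and is
absorbed by idempotence. -/
lemma foldl_memStep_absorb {L : List (Step n)} {j : Fin n} (hm : Step.measure j ∉ L)
    (hu : Step.undo j ∉ L) (hr : (Step.choose j ∈ L ∧ op j) ∨ Step.disclose j ∈ L)
    (Φ : (Fin n → ZMod d) → H) :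
    L.foldl (M.memStep op f) (memReveal j (f j) Φ) = L.foldl (M.memStep op f) Φ := by
  obtain ⟨s, hs, hsr⟩ : ∃ s ∈ L, ∀ Φ, M.memStep op f Φ s = memReveal j (f j) Φ := by
    rcases hr with ⟨h, ho⟩ | h
    · exact ⟨_, h, fun Φ => by simp [memStep, ho]⟩
    · exact ⟨_, h, fun Φ => rfl⟩
  obtain ⟨L₁, L₂, rfl⟩ := List.mem_iff_append.1 hs
  simp only [List.mem_append, List.mem_cons, not_or] at hm hu
  rw [List.foldl_append, List.foldl_append, List.foldl_cons, List.foldl_cons,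
    M.foldl_memStep_memReveal op f hm.1 hu.1, hsr, hsr, memReveal_idem]

/-- An outcome that is revealed later on may as well be revealed now. -/
lemma foldl_stepsFrom_absorb {p a : Finset (Fin n)} {Cs : List (Finset (Fin n))} {j : Fin n}
    (hap : a ⊆ p) (hj : j ∈ a) (ho : Step.choose j ∈ stepsFrom p a Cs → op j)
    (Φ : (Fin n → ZMod d) → H) :
    (stepsFrom p a Cs).foldl (M.memStep op f) (memReveal j (f j) Φ) =
      (stepsFrom p a Cs).foldl (M.memStep op f) Φ := by
  induction Cs generalizing p a Φ with
  | nil =>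
    rw [stepsFrom]
    exact M.foldl_memStep_absorb op f (by simp) (by simp) (by simp [hj]) Φ
  | cons C Cs ih =>
    have hjp := hap hj
    rw [stepsFrom] at ho ⊢
    -- If `j ∈ C`, memory `j` survives this round and the projection passes through it. Otherwise
    -- the choice in this round absorbs it before the undoing.
    by_cases hC : j ∈ C
    · rw [List.foldl_append]
      conv_rhs => rw [List.foldl_append]
      rw [M.foldl_memStep_memReveal op f]
      · refine ih ?_ (by simp [hC, hj]) (fun h => ho (List.mem_append_right _ h)) _
        intro i hi
        simp only [Finset.mem_union, Finset.mem_inter, Finset.mem_sdiff] at hi ⊢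
        tauto
      · simp [hjp]
      · simp [hC]
    · have hm : Step.choose j ∈ ((List.finRange n).filter (· ∈ a \ C)).map Step.choose := by
        simp [hj, hC]
      simp only [List.append_assoc] at ho ⊢
      rw [List.foldl_append]
      conv_rhs => rw [List.foldl_append]
      rw [M.foldl_memStep_absorb op f (by simp) (by simp)
        (Or.inl ⟨hm, ho (List.mem_append_left _ hm)⟩)]

end Reveal

/-! ### Conservation of the total weight -/

lemma memStep_congr (op : Fin n → Prop) (s : Step n) (f f' : Fin n → ZMod d)
    (Φ : (Fin n → ZMod d) → H) (h : ∀ j, revealLabel op s = some j → f j = f' j) :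
    M.memStep op f Φ s = M.memStep op f' Φ s := by
  cases s with
  | measure i => rfl
  | undo i => rfl
  | choose i =>
    simp only [memStep]
    split_ifs with ho
    · rw [h i (by simp [revealLabel, ho])]
    · rfl
  | disclose i => simp only [memStep, h i rfl]

lemma sum_memNormSq_foldl (op : Fin n → Prop) (L : List (Step n))
    (hL : (L.filterMap (revealLabel op)).Nodup) (Φ : (Fin n → ZMod d) → H) :
    ∑ f ∈ supportedOn (· ∈ L.filterMap (revealLabel op)),
      memNormSq (L.foldl (M.memStep op f) Φ) = memNormSq Φ := by
  refine sum_foldl_instruments (revealLabel op) (M.memStep op) memNormSq (M.memStep_congr op)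
    ?_ ?_ L hL Φ
  · intro s f Φ h
    cases s with
    | measure i => exact M.memNormSq_memCtrl _ _ _
    | undo i => exact M.memNormSq_memCtrl _ _ _
    | choose i =>
      have : ¬ op i := by simpa [revealLabel] using h
      simp [memStep, this]
    | disclose i => simp [revealLabel] at h
  · intro s v f Φ h
    rw [← sum_memNormSq_memReveal v]
    cases s with
    | measure i => simp [revealLabel] at h
    | undo i => simp [revealLabel] at h
    | choose i =>
      simp only [revealLabel, Option.ite_none_right_eq_some, Option.some.injEq] at h
      obtain ⟨h, rfl⟩ := h
      simp [memStep, h]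
    | disclose i =>
      simp only [revealLabel, Option.some.injEq] at h
      subst h
      simp [memStep]

/-! ### Protocols in which nothing is revealed before a given measurement -/

/-- The projectors of the measurements in `A` commute. -/
def Compatible (A : Finset (Fin n)) : Prop :=
  ∀ i ∈ A, ∀ j ∈ A, ∀ a b, Commute (M.proj i a) (M.proj j b)

/-- `Φ` is obtained from `φ` by the measurements in `A`, modelled unitarily. -/
def IsActiveState (A : Finset (Fin n)) (φ : H) (Φ : (Fin n → ZMod d) → H) : Prop :=
  ∃ l : List (Fin n), l.Nodup ∧ (∀ j, j ∈ l ↔ j ∈ A) ∧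
    Φ = l.foldl (fun Φ j => M.memCtrl j (fun m => -m) Φ) (ready φ)

variable {M} {A : Finset (Fin n)} {φ : H} {Φ : (Fin n → ZMod d) → H}

lemma IsActiveState.measure (h : M.IsActiveState A φ Φ) (op : Fin n → Prop)
    (f : Fin n → ZMod d) {l : List (Fin n)} (hl : l.Nodup) (hd : ∀ j ∈ l, j ∉ A) :
    M.IsActiveState (A ∪ l.toFinset) φ ((l.map Step.measure).foldl (M.memStep op f) Φ) := by
  obtain ⟨l₀, hl₀, hm, rfl⟩ := h
  refine ⟨l₀ ++ l, ?_, fun j => by simp [hm], ?_⟩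
  · rw [List.nodup_append']
    exact ⟨hl₀, hl, fun j hj hj' => hd j hj' ((hm j).1 hj)⟩
  · rw [List.foldl_append, List.foldl_map]
    rfl

lemma foldl_memCtrl_perm (hA : M.Compatible A) {l l' : List (Fin n)}
    (hl : ∀ j ∈ l, j ∈ A) (hp : l.Perm l') :
    l.foldl (fun Φ j => M.memCtrl j (fun m => -m) Φ) Φ =
      l'.foldl (fun Φ j => M.memCtrl j (fun m => -m) Φ) Φ := by
  refine hp.foldl_eq' (fun i hi j hj Φ => ?_) Φ
  by_cases hij : i = j
  · rw [hij]
  · exact M.memCtrl_comm (Ne.symm hij) (fun a b => hA j (hl j hj) i (hl i hi) a b) _ _ Φ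

/-- Compatible controlled shifts commute, so the measurement to be undone can be taken as the last
one performed, where its inverse cancels it. -/
lemma IsActiveState.undo (h : M.IsActiveState A φ Φ) (hA : M.Compatible A)
    (op : Fin n → Prop) (f : Fin n → ZMod d) {l : List (Fin n)} (hl : l.Nodup)
    (hs : ∀ j ∈ l, j ∈ A) :
    M.IsActiveState (A \ l.toFinset) φ ((l.map Step.undo).foldl (M.memStep op f) Φ) := by
  induction l generalizing A Φ with
  | nil => simpa using h
  | cons j l ih =>
    rw [List.nodup_cons] at hl
    obtain ⟨l₀, hl₀, hm, rfl⟩ := h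
    have hj : j ∈ l₀ := (hm j).2 (hs j (by simp))
    have hp : l₀.Perm (l₀.erase j ++ [j]) :=
      (List.perm_cons_erase hj).trans (List.perm_append_singleton _ _).symm
    have he : A \ (j :: l).toFinset = A.erase j \ l.toFinset := by
      ext i; simp; tauto
    rw [he, List.map_cons, List.foldl_cons, foldl_memCtrl_perm hA (fun i hi => (hm i).1 hi) hp,
      List.foldl_append, List.foldl_cons, List.foldl_nil, memStep, memCtrl_inverse]
    refine ih ⟨_, hl₀.erase j, fun i => ?_, rfl⟩ ?_ hl.2 ?_
    · rw [hl₀.mem_erase_iff, Finset.mem_erase, hm]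
    · exact fun i hi k hk => hA i (Finset.mem_of_mem_erase hi) k (Finset.mem_of_mem_erase hk)
    · intro i hi
      rw [Finset.mem_erase]
      exact ⟨fun h => hl.1 (h ▸ hi), hs i (by simp [hi])⟩

/-- By commutation `j` can be measured first, directly on `φ`, where branch `v` carries `M.proj j v
φ = 0`; the other measurements leave memory `j` alone. -/
lemma IsActiveState.memReveal_eq_zero (h : M.IsActiveState A φ Φ) (hA : M.Compatible A)
    {j : Fin n} (hj : j ∈ A) {v : ZMod d} (hv : M.proj j v φ = 0) :
    memReveal j v Φ = 0 := by
  obtain ⟨l, hl, hm, rfl⟩ := h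
  have hjl : j ∈ l := (hm j).2 hj
  rw [foldl_memCtrl_perm hA (fun i hi => (hm i).1 hi) (List.perm_cons_erase hjl), List.foldl_cons]
  have h1 : memReveal j v (M.memCtrl j (fun m => -m) (ready φ)) = 0 := by
    funext a
    simp only [memReveal, memCtrl, Pi.zero_apply]
    split_ifs with ha
    · refine Finset.sum_eq_zero fun m _ => ?_
      unfold ready
      split_ifs with h0
      · have := congrFun h0 j
        rw [Function.update_self, ha, Pi.zero_apply, ← sub_eq_add_neg, sub_eq_zero] at this
        rw [← this, hv]
      · simp
    · rfl
  -- The list consists of `measure` steps only, so the values given for `op` and `f` play no role.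
  have h2 := M.foldl_memStep_memReveal (fun _ => True) 0
    (L := (l.erase j).map Step.measure) (j := j) (by simp [hl.mem_erase_iff]) (by simp) v
    (M.memCtrl j (fun m => -m) (ready φ))
  rw [h1, foldl_memStep_zero, List.foldl_map] at h2
  exact h2.symm

/-- The first outcome to be revealed is never one that is impossible in the state `φ`. -/
lemma foldl_stepsFrom_eq_zero {op : Fin n → Prop} {f : Fin n → ZMod d} {j : Fin n}
    (hop : ∀ i, op i → i = j) {Cs : List (Finset (Fin n))} (hCs : ∀ C ∈ Cs, M.Compatible C)
    {p : Finset (Fin n)} (hA : M.Compatible A) (hap : A ⊆ p) (hjp : j ∉ p)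
    (hj : ∃ C ∈ Cs, j ∈ C) (ho : Step.choose j ∈ stepsFrom p A Cs → op j)
    (hv : M.proj j (f j) φ = 0) (h : M.IsActiveState A φ Φ) :
    (stepsFrom p A Cs).foldl (M.memStep op f) Φ = 0 := by
  induction Cs generalizing p A Φ with
  | nil => simp at hj
  | cons C Cs ih =>
    have hsub : A ∩ C ∪ C \ p ⊆ p ∪ C := by
      intro i hi
      simp only [Finset.mem_union, Finset.mem_inter, Finset.mem_sdiff] at hi ⊢
      tauto
    have hC : M.Compatible (A ∩ C ∪ C \ p) := by
      have : A ∩ C ∪ C \ p ⊆ C := by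
        intro i hi
        simp only [Finset.mem_union, Finset.mem_inter, Finset.mem_sdiff] at hi
        tauto
      exact fun i hi k hk => hCs C (by simp) i (this hi) k (this hk)
    have hnd (q : Fin n → Bool) : ((List.finRange n).filter q).Nodup :=
      (List.nodup_finRange n).filter _
    rw [stepsFrom] at ho ⊢
    rw [List.foldl_append, List.foldl_append, List.foldl_append]
    -- Only `j` may be revealed by choice, and it has not been performed yet.
    have hch : (((List.finRange n).filter (· ∈ A \ C)).map Step.choose).foldl
        (M.memStep op f) Φ = Φ := by
      have : ∀ i ∈ (List.finRange n).filter (· ∈ A \ C), ¬ op i := by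
        intro i hi hi'
        rw [hop i hi'] at hi
        simp only [List.mem_filter, Finset.mem_sdiff, decide_eq_true_eq] at hi
        exact hjp (hap hi.2.1)
      generalize (List.finRange n).filter (· ∈ A \ C) = l at this
      induction l with
      | nil => rfl
      | cons i l ih =>
        rw [List.map_cons, List.foldl_cons, memStep, if_neg (this i (by simp))]
        exact ih fun i' hi' => this i' (by simp [hi'])
    rw [hch]
    have h1 := h.undo hA op f (hnd (· ∈ A \ C)) (by simp +contextual)
    have h2 := h1.measure op f (hnd (· ∈ C \ p)) (by
      intro i hi hi'
      simp only [List.mem_filter, Finset.mem_sdiff, decide_eq_true_eq] at hi hi'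
      exact hi.2.2 (hap hi'.1))
    have he : (A \ ((List.finRange n).filter (· ∈ A \ C)).toFinset ∪
        ((List.finRange n).filter (· ∈ C \ p)).toFinset) = A ∩ C ∪ C \ p := by
      ext i; simp; tauto
    rw [he] at h2
    -- In the round where `j` is first measured, its later revelation is moved to the present and
    -- annihilates the state; other disclosures at the end no longer matter.
    by_cases hjC : j ∈ C
    · have hjA : j ∈ A ∩ C ∪ C \ p := by simp [hjC, hjp]
      rw [← M.foldl_stepsFrom_absorb op f hsub hjA
        (fun h => ho (List.mem_append_right _ h)),
        h2.memReveal_eq_zero hC hjA hv, foldl_memStep_zero]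
    · refine ih (fun C' hC' => hCs C' (by simp [hC'])) hC hsub (by simp [hjp, hjC]) ?_
        (fun h => ho (List.mem_append_right _ h)) h2
      simpa [hjC] using hj

end QuantumKSModel

namespace QuantumKSModel

variable {d : ℕ} [NeZero d] {n K : ℕ} {H : Type*} [NormedAddCommGroup H]
  [InnerProductSpace ℂ H] [CompleteSpace H] (M : QuantumKSModel d n K H)

/-! ### The Bobs' outcomes and the contexts -/

lemma ctxProj_eq_prod (k : Fin (K + 1)) (l : List (Fin n)) (hl : l.Nodup)
    (hm : ∀ j, j ∈ l ↔ j ∈ M.ctx k) (g : Fin n → ZMod d) :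
    M.ctxProj k (fun j => g j) = (l.map fun j => M.proj j (g j)).prod := by
  classical
  let l' : List (M.ctx k) := l.attachWith (· ∈ M.ctx k) fun j hj => (hm j).1 hj
  have hl' : l'.map Subtype.val = l := List.attachWith_map_subtype_val _
  have hnd : l'.Nodup := List.Nodup.of_map Subtype.val (by rw [hl']; exact hl)
  have hu : (Finset.univ : Finset (M.ctx k)) = l'.toFinset := by
    ext j
    simp only [Finset.mem_univ, List.mem_toFinset, true_iff]
    have : j.1 ∈ l'.map Subtype.val := by rw [hl', hm]; exact j.2
    obtain ⟨i, hi, hij⟩ := List.mem_map.1 this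
    rwa [← Subtype.ext hij]
  have h1 := Finset.noncommProd_toFinset l' (fun j : M.ctx k => M.proj j (g j))
    (fun i _ j _ _ => M.compatible k i i.2 j j.2 (g i) (g j)) hnd
  have h2 : (l'.map fun j : M.ctx k => M.proj j (g j)) = l.map fun j => M.proj j (g j) := by
    conv_rhs => rw [← hl', List.map_map]
    rfl
  rw [← h2, ← h1]
  unfold ctxProj
  congr 1

lemma bobState_eq_smul (C : Finset (Fin n)) {y : Fin n → Choice} {b : Fin n → ZMod d}
    (h₁ : ∀ j ∈ C, y j = Choice.one) (h₂ : ∀ j, j ∉ C → y j = Choice.two)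
    (hb : ∀ j, j ∉ C → b j = 0) :
    ∃ c : ℂ, c ≠ 0 ∧ M.bobState y b =
      c • (((List.finRange n).filter (· ∈ C)).map fun j => M.proj j (b j)).prod M.ψ := by
  obtain ⟨e, he, hB⟩ : ∃ e : ℂ, e ≠ 0 ∧ ∀ j,
      M.bobOp (fun j m => star (bobVec (y j) (b j) m)) j =
        if j ∈ C then M.proj j (b j) else e • 1 := by
    -- The Fourier vector of outcome `0` has all entries `1/√d`, so by completeness the Bob's
    -- operator is that scalar.
    refine ⟨star ((Real.sqrt d : ℝ) : ℂ)⁻¹, ?_, fun j => ?_⟩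
    · simp [NeZero.ne d]
    · split_ifs with hj
      · simp only [bobOp, h₁ j hj, bobVec]
        rw [Finset.sum_eq_single (b j)] <;> simp +contextual
      · simp only [bobOp, h₂ j hj, hb j hj, bobVec, zero_mul, AddChar.map_zero_eq_one, mul_one]
        rw [← Finset.smul_sum, M.complete]
  unfold bobState
  generalize List.finRange n = l
  induction l with
  | nil => exact ⟨1, one_ne_zero, by simp⟩
  | cons j l ih =>
    obtain ⟨c, hc, ih⟩ := ih
    by_cases hj : j ∈ C
    · refine ⟨c, hc, ?_⟩
      rw [List.map_cons, List.prod_cons, mul_apply_eq_comp, ih, hB, if_pos hj,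
        List.filter_cons_of_pos (by simpa using hj), List.map_cons, List.prod_cons,
        mul_apply_eq_comp, map_smul]
    · refine ⟨e * c, mul_ne_zero he hc, ?_⟩
      rw [List.map_cons, List.prod_cons, mul_apply_eq_comp, ih, hB, if_neg hj,
        List.filter_cons_of_neg (by simpa using hj), mul_smul]
      rfl

lemma bobState_eq_smul_ctxProj (k : Fin (K + 1)) {y : Fin n → Choice} {b : Fin n → ZMod d}
    (h₁ : ∀ j ∈ M.ctx k, y j = Choice.one) (h₂ : ∀ j, j ∉ M.ctx k → y j = Choice.two)
    (hb : ∀ j, j ∉ M.ctx k → b j = 0) :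
    ∃ c : ℂ, c ≠ 0 ∧ M.bobState y b = c • M.ctxProj k (fun j => b j) M.ψ := by
  rw [M.ctxProj_eq_prod k _ ((List.nodup_finRange n).filter (· ∈ M.ctx k)) (by simp)]
  exact M.bobState_eq_smul _ h₁ h₂ hb

lemma bobState_plus {y : Fin n → Choice} (hy : ∀ j, y j = Choice.two) :
    ∃ c : ℂ, c ≠ 0 ∧ M.bobState y 0 = c • M.ψ := by
  obtain ⟨c, hc, h⟩ := M.bobState_eq_smul ∅ (y := y) (b := 0) (by simp) (by simp [hy]) (by simp)
  exact ⟨c, hc, by simpa using h⟩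

lemma ψ_ne_zero : M.ψ ≠ 0 := by
  intro h
  simpa [h] using M.norm_ψ

lemma proj_ctxProj_eq_zero (k : Fin (K + 1)) (g : Fin n → ZMod d) {j : Fin n}
    (hj : j ∈ M.ctx k) {v : ZMod d} (hv : v ≠ g j) (x : H) :
    M.proj j v (M.ctxProj k (fun j => g j) x) = 0 := by
  rw [M.ctxProj_eq_prod k _ ((List.nodup_finRange n).filter (· ∈ M.ctx k)) (by simp)]
  obtain ⟨s, t, hst⟩ := List.mem_iff_append.1
    (show j ∈ (List.finRange n).filter (· ∈ M.ctx k) by simpa using hj)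
  have hs : ∀ i ∈ s, i ∈ M.ctx k := by
    intro i hi
    have : i ∈ (List.finRange n).filter (· ∈ M.ctx k) := by rw [hst]; simp [hi]
    simpa using this
  have hc : Commute (M.proj j v) (s.map fun j => M.proj j (g j)).prod := by
    refine Commute.list_prod_right _ _ fun T hT => ?_
    obtain ⟨i, hi, rfl⟩ := List.mem_map.1 hT
    exact M.compatible k j hj i (hs i hi) v (g i)
  rw [hst, List.map_append, List.prod_append, List.map_cons, List.prod_cons,
    ← mul_apply_eq_comp, ← mul_assoc, hc.eq, mul_assoc, ← mul_assoc (M.proj j v),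
    M.orthogonal j v (g j) hv, zero_mul, mul_zero, zero_apply]

/-- Some joint outcome of a context has positive probability. -/
lemma exists_ctxBorn_pos (k : Fin (K + 1)) : ∃ m, 0 < M.ctxBorn k m := by
  have h := sum_foldl_instruments (O := ZMod d) (some : Fin n → Option (Fin n))
    (fun g x j => M.proj j (g j) x) (fun x => ‖x‖ ^ 2)
    (fun j g g' x hg => by simp only [hg j rfl]) (fun s g e hs => by simp at hs)
    (fun j v g x hv => by
      obtain rfl : j = v := by simpa using hv
      simpa using M.sum_norm_sq_proj j x)
    ((List.finRange n).filter (· ∈ M.ctx k)).reverse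
    (by simpa using (List.nodup_finRange n).filter _) M.ψ
  rw [M.norm_ψ, one_pow] at h
  by_contra! h0
  refine one_ne_zero (h.symm.trans (Finset.sum_eq_zero fun g _ => ?_))
  refine le_antisymm (le_of_eq_of_le ?_ (h0 fun j => g j)) (by positivity)
  rw [ctxBorn, M.ctxProj_eq_prod k _ ((List.nodup_finRange n).filter (· ∈ M.ctx k)) (by simp),
    List.foldl_reverse]
  congr 2
  generalize (List.finRange n).filter (· ∈ M.ctx k) = l
  induction l with
  | nil => simp
  | cons j l ih => rw [List.map_cons, List.prod_cons, mul_apply_eq_comp, ← ih, List.foldr_cons]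

lemma ctxBorn_nonneg (k : Fin (K + 1)) (m : M.ctx k → ZMod d) : 0 ≤ M.ctxBorn k m :=
  sq_nonneg _

/-! ### The probabilities of the protocol -/

lemma steps_eq : M.steps = ((List.finRange n).filter (· ∈ M.ctx 0)).map Step.measure ++
    stepsFrom (M.ctx 0) (M.ctx 0) (List.ofFn fun k : Fin K => M.ctx k.succ) := by
  rw [steps, List.ofFn_succ, stepsFrom]
  simp

lemma accessible_inl_iff (z : M.Setting → Choice) (j : Fin n) :
    M.lfScenario.accessible z (Sum.inl j) ↔
      j ∈ M.steps.filterMap (revealLabel (M.Opens z)) := by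
  rw [mem_filterMap_revealLabel]
  exact or_congr_left ⟨fun h => ⟨h.1, h⟩, And.right⟩

lemma nodup_steps (op : Fin n → Prop) : (M.steps.filterMap (revealLabel op)).Nodup :=
  nodup_filterMap_revealLabel (Finset.Subset.refl _)

lemma protocolBorn_nonneg (z : M.Setting → Choice) (f b : Fin n → ZMod d) :
    0 ≤ M.protocolBorn z f b :=
  Finset.sum_nonneg fun _ _ => by positivity

lemma protocolBorn_congr (z : M.Setting → Choice) {f f' : Fin n → ZMod d} (b : Fin n → ZMod d)
    (h : ∀ j, M.lfScenario.accessible z (Sum.inl j) → f j = f' j) :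
    M.protocolBorn z f b = M.protocolBorn z f' b := by
  rw [protocolBorn_eq, protocolBorn_eq, foldl_congr_labels (revealLabel (M.Opens z))
    (M.memStep (M.Opens z)) (M.memStep_congr (M.Opens z)) M.steps f f']
  exact fun j hj => h j ((M.accessible_inl_iff z j).2 hj)

/-- The Bobs' joint probability does not depend on Alice's choices, since her operations preserve
the total weight. -/
lemma sum_protocolBorn (z : M.Setting → Choice) (b : Fin n → ZMod d) :
    ∑ f ∈ supportedOn (fun j => M.lfScenario.accessible z (Sum.inl j)), M.protocolBorn z f b =
      ‖M.bobState (fun j => z (Sum.inr j)) b‖ ^ 2 := by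
  simp only [protocolBorn_eq, accessible_inl_iff]
  rw [M.sum_memNormSq_foldl _ _ (M.nodup_steps _), memNormSq_ready]

lemma sum_emp (z : M.Setting → Choice) :
    ∑ g ∈ supportedOn (M.lfScenario.accessible z), M.lfScenario.emp z g = 1 := by
  rw [← M.sum_norm_sq_bobState fun j => z (Sum.inr j)]
  simp only [← M.sum_protocolBorn]
  rw [← Finset.sum_product']
  refine Finset.sum_bij' (fun g _ => (fun j => g (Sum.inr j), fun j => g (Sum.inl j)))
    (fun x _ => Sum.elim x.2 x.1) ?_ ?_ ?_ ?_ ?_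
  · intro g hg
    rw [mem_supportedOn] at hg
    simp only [Finset.mem_product, Finset.mem_univ, true_and, mem_supportedOn]
    exact fun j hj => hg _ hj
  · intro x hx
    simp only [Finset.mem_product, Finset.mem_univ, true_and, mem_supportedOn] at hx
    rw [mem_supportedOn]
    rintro (j | j) hj
    · exact hx j hj
    · exact absurd trivial hj
  · intro g _
    funext v
    cases v <;> rfl
  · intro x _
    rfl
  · intro g _
    rfl

/-- The predictions of quantum theory are marginals of a distribution on all the outcomes. -/
lemma exists_reproduces (z : M.Setting → Choice) :
    ∃ p ∈ stdSimplex ℝ (Fin n ⊕ Fin n → ZMod d), M.lfScenario.Reproduces z p := by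
  refine EWFScenario.exists_reproduces (fun g => M.protocolBorn_nonneg _ _ _) (M.sum_emp z) ?_
  intro g g' h
  have hb : (fun j => g' (Sum.inr j)) = fun j => g (Sum.inr j) :=
    funext fun j => h (Sum.inr j) trivial
  change M.protocolBorn z _ _ = M.protocolBorn z _ _
  rw [hb]
  exact M.protocolBorn_congr z _ fun j hj => h (Sum.inl j) hj

lemma exists_protocolBorn_plus_pos {z : M.Setting → Choice}
    (hz : ∀ j, z (Sum.inr j) = Choice.two) : ∃ f, 0 < M.protocolBorn z f 0 := by
  obtain ⟨c, hc, h⟩ := M.bobState_plus (y := fun j => z (Sum.inr j)) hz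
  by_contra! h0
  have := M.sum_protocolBorn z 0
  rw [Finset.sum_eq_zero fun f _ => le_antisymm (h0 f) (M.protocolBorn_nonneg _ _ _), h] at this
  exact pow_ne_zero 2 (norm_ne_zero_iff.2 (smul_ne_zero hc M.ψ_ne_zero)) this.symm

omit [NeZero d] [InnerProductSpace ℂ H] [CompleteSpace H] in
open Classical in
lemma foldr_memReveal_apply (l : List (Fin n)) (v : Fin n → ZMod d)
    (Φ : (Fin n → ZMod d) → H) (a : Fin n → ZMod d) :
    l.foldr (fun j Φ => memReveal j (v j) Φ) Φ a = if ∀ j ∈ l, a j = v j then Φ a else 0 := by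
  induction l with
  | nil => simp
  | cons j l ih =>
    simp only [List.foldr_cons, memReveal, ih, List.forall_mem_cons]
    split_ifs <;> first | rfl | tauto

/-- If all the outcomes are revealed, then the possible outcomes of the first context occur together
with the outcome `+` of all the Bobs. -/
lemma exists_protocolBorn_ctx_zero_pos {z : M.Setting → Choice}
    (hx : ∀ s, z (Sum.inl s) = Choice.one) (hy : ∀ j, z (Sum.inr j) = Choice.two)
    {m : M.ctx 0 → ZMod d} (hm : 0 < M.ctxBorn 0 m) :
    ∃ f : Fin n → ZMod d, (∀ j : M.ctx 0, f j = m j) ∧ 0 < M.protocolBorn z f 0 := by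
  classical
  obtain ⟨v, rfl, hv0⟩ : ∃ v : Fin n → ZMod d, (fun j : M.ctx 0 => v j) = m ∧
      ∀ j, j ∉ M.ctx 0 → v j = 0 :=
    ⟨fun j => if h : j ∈ M.ctx 0 then m ⟨j, h⟩ else 0, funext fun j => by simp,
      fun j hj => by simp [hj]⟩
  obtain ⟨c, hc, hbob⟩ := M.bobState_plus (y := fun j => z (Sum.inr j)) hy
  obtain ⟨l, hl⟩ : ∃ l, (List.finRange n).filter (· ∈ M.ctx 0) = l := ⟨_, rfl⟩
  have hnd : l.Nodup := hl ▸ (List.nodup_finRange n).filter _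
  have hml : ∀ j, j ∈ l ↔ j ∈ M.ctx 0 := by simp [← hl]
  obtain ⟨rest, hrest⟩ : ∃ r, stepsFrom (M.ctx 0) (M.ctx 0)
    (List.ofFn fun k : Fin K => M.ctx k.succ) = r := ⟨_, rfl⟩
  have hsteps : M.steps = l.map Step.measure ++ rest := by rw [M.steps_eq, hl, hrest]
  let Φ := l.foldl (fun Φ j => M.memCtrl j (fun m => -m) Φ) (ready (c • M.ψ))
  have hborn (f) : M.protocolBorn z f 0 =
      memNormSq (rest.foldl (M.memStep (M.Opens z) f) Φ) := by
    rw [protocolBorn_eq, hbob, hsteps, List.foldl_append, List.foldl_map]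
    rfl
  have habs (f : Fin n → ZMod d) (j) (hj : j ∈ l) (Ψ : (Fin n → ZMod d) → H) :
      rest.foldl (M.memStep (M.Opens z) f) (memReveal j (f j) Ψ) =
        rest.foldl (M.memStep (M.Opens z) f) Ψ := by
    rw [← hrest]
    refine M.foldl_stepsFrom_absorb _ _ (Finset.Subset.refl _) ((hml j).1 hj) (fun h => ?_) Ψ
    have h' : Step.choose j ∈ M.steps := by
      rw [hsteps, ← hrest]
      exact List.mem_append_right _ h
    exact ⟨h', hx _⟩
  let Ψ := l.foldr (fun j Φ => memReveal j (v j) Φ) Φ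
  have hΨ (f : Fin n → ZMod d) (hf : ∀ j ∈ l, f j = v j) :
      rest.foldl (M.memStep (M.Opens z) f) Ψ = rest.foldl (M.memStep (M.Opens z) f) Φ := by
    have (l' : List (Fin n)) (hl' : ∀ j ∈ l', j ∈ l) : rest.foldl (M.memStep (M.Opens z) f)
        (l'.foldr (fun j Φ => memReveal j (v j) Φ) Φ) =
        rest.foldl (M.memStep (M.Opens z) f) Φ := by
      induction l' with
      | nil => rfl
      | cons j l' ih =>
        rw [List.foldr_cons, ← hf j (hl' j (by simp)), habs f j (hl' j (by simp)),
          ih fun i hi => hl' i (by simp [hi])]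
    exact this l fun j hj => hj
  have hΨv : Ψ v ≠ 0 := by
    have h1 : Ψ v = c • M.ctxProj 0 (fun j => v j) M.ψ := by
      change l.foldr (fun j Φ => memReveal j (v j) Φ) Φ v = _
      rw [foldr_memReveal_apply, if_pos fun _ _ => rfl]
      change l.foldl (fun Φ j => M.memCtrl j (fun m => -m) Φ) (ready (c • M.ψ)) v = _
      rw [List.foldl_eq_foldr_reverse, M.foldr_memCtrl_ready _ (List.nodup_reverse.2 hnd),
        if_pos (fun j hj => hv0 j (by simpa [hml] using hj)), ← M.ctxProj_eq_prod 0 _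
          (List.nodup_reverse.2 hnd) (by simp [hml]), map_smul]
    rw [h1]
    refine smul_ne_zero hc fun h => ?_
    simp [ctxBorn, h] at hm
  have hpos : 0 < memNormSq Ψ :=
    Finset.sum_pos' (fun _ _ => by positivity) ⟨v, Finset.mem_univ _, by positivity⟩
  -- The projected state `Ψ` is nonzero and the remaining steps conserve its weight, so some `f` has
  -- positive weight. It must agree with `v` on the first context, since otherwise the projection
  -- absorbed later would already annihilate `Ψ`.
  have hsum := M.sum_memNormSq_foldl (M.Opens z) rest (by
    rw [← hrest]; exact nodup_filterMap_revealLabel (Finset.Subset.refl _)) Ψ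
  rw [← hsum] at hpos
  obtain ⟨f, _, hf⟩ := Finset.exists_lt_of_sum_lt
    (f := fun _ => (0 : ℝ)) (by simpa using hpos)
  have hfv : ∀ j ∈ l, f j = v j := by
    intro j hj
    by_contra hne
    rw [← habs f j hj] at hf
    have : memReveal j (f j) Ψ = 0 := by
      funext a
      simp only [memReveal, Pi.zero_apply]
      split_ifs with ha
      · change l.foldr (fun j Φ => memReveal j (v j) Φ) Φ a = 0
        rw [foldr_memReveal_apply, if_neg]
        exact fun h => hne (ha ▸ h j hj)
      · rfl
    rw [this, foldl_memStep_zero, memNormSq_zero] at hf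
    exact lt_irrefl _ hf
  exact ⟨f, fun j => hfv j ((hml j).2 j.2), by rwa [hborn, ← hΨ f hfv]⟩

lemma protocolBorn_eq_zero_of_ctxBorn (k : Fin (K + 1)) {z : M.Setting → Choice}
    (h₁ : ∀ j ∈ M.ctx k, z (Sum.inr j) = Choice.one)
    (h₂ : ∀ j, j ∉ M.ctx k → z (Sum.inr j) = Choice.two) (f : Fin n → ZMod d)
    {b : Fin n → ZMod d} (hb : ∀ j, j ∉ M.ctx k → b j = 0)
    (h : M.ctxBorn k (fun j => b j) = 0) : M.protocolBorn z f b = 0 := by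
  obtain ⟨c, -, hc⟩ := M.bobState_eq_smul_ctxProj k (y := fun j => z (Sum.inr j)) h₁ h₂ hb
  have h0 : M.ctxProj k (fun j => b j) M.ψ = 0 := by simpa [ctxBorn] using h
  have hr : ready (d := d) (n := n) (0 : H) = 0 := by funext a; simp [ready]
  rw [protocolBorn_eq, hc, h0, smul_zero, hr, foldl_memStep_zero, memNormSq_zero]

/-- If only the outcome of friend `j` may be revealed before the end, then it agrees with the outcome
of Bob `j`. -/
lemma protocolBorn_eq_zero_of_ne (k : Fin (K + 1)) {z : M.Setting → Choice} {j : Fin n}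
    (hj : j ∈ M.ctx k) (hx : ∀ s, z (Sum.inl s) = Choice.one ↔ s.1 = j)
    (h₁ : ∀ j ∈ M.ctx k, z (Sum.inr j) = Choice.one)
    (h₂ : ∀ j, j ∉ M.ctx k → z (Sum.inr j) = Choice.two) {f b : Fin n → ZMod d}
    (hb : ∀ j, j ∉ M.ctx k → b j = 0) (hne : f j ≠ b j) : M.protocolBorn z f b = 0 := by
  obtain ⟨c, -, hc⟩ := M.bobState_eq_smul_ctxProj k (y := fun j => z (Sum.inr j)) h₁ h₂ hb
  rw [protocolBorn_eq, steps, foldl_stepsFrom_eq_zero (A := ∅) (j := j)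
    (φ := M.bobState (fun j => z (Sum.inr j)) b), memNormSq_zero]
  · rintro i ⟨hi, hzi⟩
    exact (hx _).1 hzi
  · intro C hC
    obtain ⟨k, rfl⟩ := List.mem_ofFn.1 hC
    exact M.compatible k
  · simp [Compatible]
  · exact Finset.Subset.refl _
  · simp
  · exact ⟨_, List.mem_ofFn.2 ⟨k, rfl⟩, hj⟩
  · exact fun h => ⟨h, (hx _).2 rfl⟩
  · rw [hc, map_smul, M.proj_ctxProj_eq_zero k b hj hne, smul_zero]
  · exact ⟨[], List.nodup_nil, by simp, rfl⟩

/-! ### Consequences of Local Friendliness -/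

section LocalFriendliness

variable {M} {P : (M.Setting → Choice) → (Fin n ⊕ Fin n → ZMod d) → ℝ}

lemma accessible_of_choose {z : M.Setting → Choice} {j : Fin n}
    (hx : ∀ s : M.AliceChoice, s.1 = j → z (Sum.inl s) = Choice.one) :
    M.lfScenario.accessible z (Sum.inl j) := by
  have : Step.choose j ∈ M.steps ∨ Step.disclose j ∈ M.steps :=
    exists_reveal_mem_stepsFrom (Or.inr ⟨by simp, by
      obtain ⟨k, hk⟩ := M.covers j
      exact ⟨_, List.mem_ofFn.2 ⟨k, rfl⟩, hk⟩⟩)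
  exact this.imp_left fun h => ⟨h, hx _ rfl⟩

lemma not_inFuture_self (s : M.AliceChoice) :
    ¬ M.lfScenario.inFuture (Sum.inl s) (Sum.inl s.1) :=
  not_sublist_choose_measure (Finset.Subset.refl _) s.1

lemma not_inFuture_ctx_zero (s : M.AliceChoice) {i : Fin n} (hi : i ∈ M.ctx 0) :
    ¬ M.lfScenario.inFuture (Sum.inl s) (Sum.inl i) := by
  obtain ⟨j, hj⟩ := s
  intro h
  change List.Sublist [Step.choose j, Step.measure i] M.steps at h
  rw [M.steps_eq, List.sublist_append_iff] at h
  obtain ⟨l₁, l₂, hl, h₁, h₂⟩ := h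
  cases l₁ with
  | nil =>
    rw [List.nil_append] at hl
    subst hl
    exact measure_notMem_stepsFrom hi (h₂.subset (by simp))
  | cons t l₁ =>
    simp only [List.cons_append, List.cons.injEq] at hl
    have := h₁.subset (show Step.choose j ∈ t :: l₁ by simp [hl.1])
    simp at this

lemma plusProb_pos (hP : M.lfScenario.LocalFriendliness P) : 0 < M.plusProb P := by
  obtain ⟨f, hf⟩ := M.exists_protocolBorn_plus_pos (z := fun _ => Choice.two) fun _ => rfl
  have hf' : 0 < M.lfScenario.emp (fun _ => Choice.two) (Sum.elim f 0) := hf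
  unfold plusProb
  refine (hP.empirical _).prob_pos (hP.absoluteness _).1 hf' ?_
  exact fun g' h j => h (Sum.inr j) trivial

lemma prob_plusCond (F : (Fin n → ZMod d) → Prop) :
    prob (M.plusCond P) F = prob (P fun _ => Choice.two)
      (fun g => F (fun j => g (Sum.inl j)) ∧ ∀ j, g (Sum.inr j) = 0) / M.plusProb P := by
  classical
  unfold prob plusCond
  rw [← Finset.sum_div]
  congr 1
  rw [← Finset.sum_fiberwise_of_maps_to (t := {f | F f}) 
    (g := fun (g : Fin n ⊕ Fin n → ZMod d) j => g (Sum.inl j))]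
  · refine Finset.sum_congr rfl fun f hf => ?_
    simp only [Finset.mem_filter, Finset.mem_univ, true_and] at hf
    unfold prob
    rw [Finset.filter_filter]
    refine Finset.sum_congr ?_ fun _ _ => rfl
    ext g
    simp only [Finset.mem_filter, Finset.mem_univ, true_and]
    constructor
    · rintro ⟨h1, h2⟩
      obtain rfl : (fun j => g (Sum.inl j)) = f := funext h1
      exact ⟨⟨hf, h2⟩, rfl⟩
    · rintro ⟨⟨_, h2⟩, rfl⟩
      exact ⟨fun _ => rfl, h2⟩
  · intro g hg
    simp only [Finset.mem_filter, Finset.mem_univ, true_and] at hg ⊢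
    exact hg.1

lemma plusCond_mem_stdSimplex (hP : M.lfScenario.LocalFriendliness P) :
    M.plusCond P ∈ stdSimplex ℝ (Fin n → ZMod d) := by
  refine ⟨fun f => div_nonneg (prob_nonneg (hP.absoluteness _).1 _) (plusProb_pos hP).le, ?_⟩
  have h : ∑ f, M.plusCond P f = prob (M.plusCond P) fun _ => True := by simp [prob]
  rw [h, prob_plusCond]
  simp only [true_and]
  exact div_self (plusProb_pos hP).ne'

/-- The event involves only the first context's friends and the Bobs, none of them in the future of
Alice's choices, so those may all be switched to `1`. -/
lemma prob_ctx_zero_pos (hP : M.lfScenario.LocalFriendliness P) {m : M.ctx 0 → ZMod d}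
    (hm : 0 < M.ctxBorn 0 m) :
    0 < prob (P fun _ => Choice.two)
      (fun g => (fun j : M.ctx 0 => g (Sum.inl j)) = m ∧ ∀ j, g (Sum.inr j) = 0) := by
  let z : M.Setting → Choice := Sum.elim (fun _ => Choice.one) fun _ => Choice.two
  obtain ⟨f, hfm, hf⟩ := M.exists_protocolBorn_ctx_zero_pos (z := z) (fun _ => rfl)
    (fun _ => rfl) hm
  rw [hP.prob_eq_of_notMem_future (Sum.elim (· ∈ M.ctx 0) fun _ => True) _ ?_ _ z ?_]
  · refine (hP.empirical _).prob_pos (hP.absoluteness _).1 (g := Sum.elim f 0) hf ?_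
    refine fun g' h => ⟨funext fun j => ?_, fun j => h (Sum.inr j) trivial⟩
    rw [h (Sum.inl j) (accessible_of_choose fun _ _ => rfl)]
    exact hfm j
  · rintro g g' h ⟨h1, h2⟩
    refine ⟨?_, fun j => (h (Sum.inr j) trivial).trans (h2 j)⟩
    rw [← h1]
    exact funext fun j => h (Sum.inl j) j.2
  · rintro (s | s) hs (i | i) hi
    · exact not_inFuture_ctx_zero s hi
    · exact id
    · exact id
    · exact absurd rfl hs

open Classical in
/-- The choices in which the Bobs of the context `k` measure in the computational basis, and only the
outcomes selected by `x` are revealed. -/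
def ctxSetting (M : QuantumKSModel d n K H) (k : Fin (K + 1)) (x : Fin n → Prop) :
    M.Setting → Choice :=
  Sum.elim (fun s => if x s.1 then Choice.one else Choice.two)
    fun j => if j ∈ M.ctx k then Choice.one else Choice.two

/-- The event involves a single friend `j`, whose outcome is not in the future of her own choice.
Switching only that choice to `1` makes her outcome accessible. -/
lemma prob_ne_eq_zero (hP : M.lfScenario.LocalFriendliness P) (k : Fin (K + 1)) {j : Fin n}
    (hj : j ∈ M.ctx k) :
    prob (P (ctxSetting M k fun _ => False))
      (fun g => g (Sum.inl j) ≠ g (Sum.inr j) ∧ ∀ i, i ∉ M.ctx k → g (Sum.inr i) = 0) = 0 := by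
  rw [hP.prob_eq_of_notMem_future (Sum.elim (· = j) fun _ => True) _ ?_ _
    (ctxSetting M k (· = j)) ?_]
  · rw [prob_eq_zero_iff (hP.absoluteness _).1]
    rintro g ⟨h1, h2⟩
    refine (hP.empirical _).eq_zero (hP.absoluteness _).1 ?_
    refine M.protocolBorn_eq_zero_of_ne k hj ?_ ?_ ?_ h2 h1
    · intro s
      simp [ctxSetting]
    · intro i hi
      simp [ctxSetting, hi]
    · intro i hi
      simp [ctxSetting, hi]
  · rintro g g' h ⟨h1, h2⟩
    rw [h (Sum.inl j) rfl, h (Sum.inr j) trivial]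
    exact ⟨h1, fun i hi => (h (Sum.inr i) trivial).trans (h2 i hi)⟩
  · rintro (s | s) hs (i | i) hi
    · have hsj : s.1 = j := by
        by_contra hne
        exact hs (by simp [ctxSetting, hne])
      obtain rfl : i = s.1 := (show i = j from hi).trans hsj.symm
      exact not_inFuture_self s
    · exact id
    · exact id
    · exact absurd rfl hs

/-- Forgetting the Bobs of context `k` leaves an event insensitive to their bases; once these are
computational, the friends of the context copy their Bobs. -/
lemma prob_ctx_eq_zero (hP : M.lfScenario.LocalFriendliness P) (k : Fin (K + 1))
    {α : Set (M.ctx k → ZMod d)} (hα : M.ctxProb k α = 0) :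
    prob (P fun _ => Choice.two)
      (fun g => (fun j : M.ctx k => g (Sum.inl j)) ∈ α ∧ ∀ j, g (Sum.inr j) = 0) = 0 := by
  have hα' := (prob_eq_zero_iff (M.ctxBorn_nonneg k) _).1 hα
  have key : prob (P fun _ => Choice.two) (fun g => (fun j : M.ctx k => g (Sum.inl j)) ∈ α ∧
      ∀ i, i ∉ M.ctx k → g (Sum.inr i) = 0) = 0 := by
    rw [hP.prob_eq_of_notMem_future (Sum.elim (fun _ => True) (· ∉ M.ctx k)) _ ?_ _
      (ctxSetting M k fun _ => False) ?_]
    · rw [prob_eq_zero_iff (hP.absoluteness _).1]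
      rintro g ⟨h1, h2⟩
      by_cases hg : ∀ j : M.ctx k, g (Sum.inl j) = g (Sum.inr j)
      · refine (hP.empirical _).eq_zero (hP.absoluteness _).1 ?_
        refine M.protocolBorn_eq_zero_of_ctxBorn k ?_ ?_ _ h2 (hα' _ ?_)
        · intro i hi
          simp [ctxSetting, hi]
        · intro i hi
          simp [ctxSetting, hi]
        · rwa [← funext hg]
      · push Not at hg
        obtain ⟨j, hj⟩ := hg
        exact (prob_eq_zero_iff (hP.absoluteness _).1 _).1 (prob_ne_eq_zero hP k j.2) g ⟨hj, h2⟩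
    · rintro g g' h ⟨h1, h2⟩
      have : (fun j : M.ctx k => g' (Sum.inl j)) = fun j : M.ctx k => g (Sum.inl j) :=
        funext fun j => h (Sum.inl j) trivial
      rw [this]
      exact ⟨h1, fun i hi => (h (Sum.inr i) hi).trans (h2 i hi)⟩
    · rintro (s | s) hs (i | i) hi
      · exact absurd (by simp [ctxSetting]) hs
      · exact id
      · exact id
      · rintro rfl
        exact hs (by simp [ctxSetting, show i ∉ M.ctx k from hi])
  rw [prob_eq_zero_iff (hP.absoluteness _).1] at key ⊢
  exact fun g hg => key g ⟨hg.1, fun i _ => hg.2 i⟩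

/-- Local Friendliness yields one global distribution that satisfies the possibilistic relations of
the model. -/
lemma globalSatisfiesPossibilistic_plusCond (hP : M.lfScenario.LocalFriendliness P)
    {α : ∀ k, Set (M.ctx k → ZMod d)} (hα : M.SatisfiesPossibilistic α) :
    M.GlobalSatisfiesPossibilistic (M.plusCond P) α := by
  refine ⟨?_, fun k hk => ?_⟩
  · obtain ⟨m, hmα, hm⟩ := (prob_pos_iff (M.ctxBorn_nonneg 0) _).1 hα.1
    rw [margProb, prob_plusCond]
    refine div_pos ((prob_ctx_zero_pos hP hm).trans_le ?_) (plusProb_pos hP)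
    refine prob_mono (hP.absoluteness _).1 fun g hg => ⟨?_, hg.2⟩
    rw [hg.1]
    exact hmα
  · rw [margProb, prob_plusCond, prob_ctx_eq_zero hP k (hα.2 k hk), zero_div]

lemma IsPossibilisticProof.not_localFriendliness {α : ∀ k, Set (M.ctx k → ZMod d)}
    (hα : M.IsPossibilisticProof α) : ¬ ∃ P, M.lfScenario.LocalFriendliness P :=
  fun ⟨P, hP⟩ => hα.2 ⟨M.plusCond P, plusCond_mem_stdSimplex hP,
    globalSatisfiesPossibilistic_plusCond hP hα.1⟩

end LocalFriendliness

/-! ### Possibilistic contextuality -/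

/-- In a possibilistically contextual model some possible outcome of some context does not extend to
a global assignment that is possible in every context. -/
lemma PossibilisticallyContextual.exists_not_extends (h : M.PossibilisticallyContextual) :
    ∃ k m, 0 < M.ctxBorn k m ∧ ∀ f : Fin n → ZMod d,
      (∀ l, 0 < M.ctxBorn l fun j => f j) → (fun j : M.ctx k => f j) ≠ m := by
  classical
  by_contra! hc
  -- If every possible outcome extends, the uniform distribution on `Z` has the empirical supports.
  let Z : Finset (Fin n → ZMod d) := {f | ∀ l, 0 < M.ctxBorn l fun j => f j}
  have hZ : Z.Nonempty := by
    obtain ⟨m, hm⟩ := M.exists_ctxBorn_pos 0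
    obtain ⟨f, hf, -⟩ := hc 0 m hm
    exact ⟨f, by simpa [Z] using hf⟩
  have hcard : (0 : ℝ) < (Z.card : ℝ)⁻¹ := by
    have := hZ.card_pos
    positivity
  have hnonneg : ∀ f, 0 ≤ if f ∈ Z then (Z.card : ℝ)⁻¹ else 0 := fun f => by
    split_ifs
    exacts [hcard.le, le_rfl]
  refine h ⟨fun f => if f ∈ Z then (Z.card : ℝ)⁻¹ else 0, ⟨hnonneg, ?_⟩, fun k m => ?_⟩
  · simp only [Finset.sum_ite_mem, Finset.univ_inter, Finset.sum_const, nsmul_eq_mul]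
    exact mul_inv_cancel₀ (inv_pos.1 hcard).ne'
  · rw [margProb, prob_pos_iff hnonneg]
    constructor
    · rintro ⟨f, rfl, hf⟩
      have : f ∈ Z := by
        by_contra hn
        simp [hn] at hf
      exact (by simpa [Z] using this : ∀ l, 0 < M.ctxBorn l fun j => f j) k
    · intro hm
      obtain ⟨f, hf, hfm⟩ := hc k m hm
      have : f ∈ Z := by simpa [Z] using hf
      exact ⟨f, hfm, by rwa [if_pos this]⟩

open Classical in
-- Forbidding every impossible outcome of the other contexts forces any assignment of positive
-- weight extending `m` to be possible in all contexts.
lemma isPossibilisticProof_of_not_extends {m : M.ctx 0 → ZMod d} (hm : 0 < M.ctxBorn 0 m)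
    (h : ∀ f : Fin n → ZMod d, (∀ l, 0 < M.ctxBorn l fun j => f j) →
      (fun j : M.ctx 0 => f j) ≠ m) :
    M.IsPossibilisticProof (Function.update (fun k => {m' | M.ctxBorn k m' = 0}) 0 {m}) := by
  refine ⟨⟨?_, fun k hk => ?_⟩, ?_⟩
  · rw [Function.update_self]
    exact (prob_pos_iff (M.ctxBorn_nonneg 0) _).2 ⟨m, rfl, hm⟩
  · rw [Function.update_of_ne hk]
    exact (prob_eq_zero_iff (M.ctxBorn_nonneg k) _).2 fun m hm => hm
  · rintro ⟨Q, hQ, h0, h1⟩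
    rw [Function.update_self] at h0
    obtain ⟨f, hfm, hf⟩ := (prob_pos_iff hQ.1 _).1 h0
    refine h f (fun l => ?_) hfm
    by_cases hl : l = 0
    · subst hl
      rwa [show (fun j : M.ctx 0 => f j) = m from hfm]
    · have hl1 := h1 l hl
      rw [Function.update_of_ne hl] at hl1
      refine lt_of_le_of_ne (M.ctxBorn_nonneg l _) fun hz => hf.ne' ?_
      exact (prob_eq_zero_iff hQ.1 _).1 hl1 f hz.symm

end QuantumKSModel

end LFKS

end

theorem mainTheorem1 {d : ℕ} [NeZero d] {n K : ℕ} {H : Type*} [NormedAddCommGroup H]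
    [InnerProductSpace ℂ H] [CompleteSpace H] (M : LFKS.QuantumKSModel d n K H) :
    -- the predictions of quantum theory in the scenario are probability distributions
    (∀ z, ∃ p ∈ stdSimplex ℝ (Fin n ⊕ Fin n → ZMod d), M.lfScenario.Reproduces z p) ∧
    -- Local Friendliness yields one distribution with the possibilistic relations of the model
    (∀ P, M.lfScenario.LocalFriendliness P →
      0 < M.plusProb P ∧ M.plusCond P ∈ stdSimplex ℝ (Fin n → ZMod d) ∧
      ∀ α, M.SatisfiesPossibilistic α → M.GlobalSatisfiesPossibilistic (M.plusCond P) α) ∧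
    -- so a possibilistic proof of contextuality is a proof that Local Friendliness fails
    ((∃ α, M.IsPossibilisticProof α) → ¬ ∃ P, M.lfScenario.LocalFriendliness P) ∧
    -- and every possibilistically contextual model has one, for a suitable choice of first context
    (M.PossibilisticallyContextual → ∃ k, ∀ σ : Equiv.Perm (Fin (K + 1)), σ 0 = k →
      (∃ α, (M.reorder σ).IsPossibilisticProof α) ∧
      ¬ ∃ P, (M.reorder σ).lfScenario.LocalFriendliness P) := by
  refine ⟨M.exists_reproduces, fun P hP => ⟨LFKS.QuantumKSModel.plusProb_pos hP,
    LFKS.QuantumKSModel.plusCond_mem_stdSimplex hP, fun α hα =>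
      LFKS.QuantumKSModel.globalSatisfiesPossibilistic_plusCond hP hα⟩,
    fun ⟨α, hα⟩ => hα.not_localFriendliness, fun h => ?_⟩
  obtain ⟨k, m, hm, hk⟩ := h.exists_not_extends
  refine ⟨k, ?_⟩
  rintro σ rfl
  -- Context `0` of the reordered model is `M.ctx (σ 0)`, and possibility in all contexts does not
  -- depend on their order.
  have hproof := (M.reorder σ).isPossibilisticProof_of_not_extends (m := m) hm fun f hf =>
    hk f fun l => by
      obtain ⟨l, rfl⟩ := σ.surjective l
      exact hf l
  exact ⟨⟨_, hproof⟩, hproof.not_localFriendliness⟩
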